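/- Let $k$ be an algebraically closed field of characteristic zero (for example $k=\overline{\mathbb{Q}}$) and put $f_c(x)=x^2+c$. An element $a\in k$ is a third critical value if there is $c_0\in k$ with $$f_{c_0}^3(0)=a\quad\text{and}\quad \frac{d f_c^3(0)}{dc}\Big|_{c=c_0}=0,$$ where $f_c^3$ denotes the third iterate. There are exactly three third critical values $a_1,a_2,a_3\in k$. For $a\in k$ let $C_{224,a}\subseteq\mathbb{P}^4_k$, with homogeneous coordinates $(q:r:s:t:z)$, be the projective algebraic set defined by $$az^2-t^2=tz-s^2,\qquad az^2-t^2=sz-q^2,\qquad az^2-t^2=-sz-r^2 .$$ Then for $a\in\{0,a_1,a_2,a_3\}$ the set $C_{224,a}$ is an irreducible curve, and its geometric genus (the genus of its normalization, i.e. the dimension over $k$ of the space of regular differentials of its function field) is $$g=\begin{cases}4 & \text{if } a=0,\\ 1 & \text{if } a\in\{a_1,a_2,a_3\}.\end{cases}$$ -/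

import Mathlib

open scoped LinearAlgebra.Projectivization
open MvPolynomial KaehlerDifferential

/-! ### Critical values of the quadratic family -/

/-- The map `f_c(x) = x² + c`. -/
def quadMap {R : Type*} [CommRing R] (c x : R) : R := x ^ 2 + c

/-- `a` is an `N`-th critical value: for some `c₀`, `f_{c₀}^N(0) = a` and the derivative with
respect to `c` of `f_c^N(0)`, regarded as a polynomial in the variable `c`, vanishes at `c₀`. -/
def IsCriticalValue {k : Type*} [Field k] (N : ℕ) (a : k) : Prop :=
  ∃ c₀ : k, (quadMap c₀)^[N] 0 = a ∧
    (Polynomial.derivative ((quadMap (Polynomial.X : Polynomial k))^[N] 0)).eval c₀ = 0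

/-! ### Projective algebraic sets and their function fields -/

section Projective

variable {k : Type*} [Field k] {n : ℕ}

/-- The common zeros in `ℙⁿ(k)` of a set of homogeneous polynomials. -/
def projZeroLocus (S : Set (MvPolynomial (Fin (n + 1)) k)) : Set (ℙ k (Fin (n + 1) → k)) :=
  {P | ∀ F ∈ S, ∀ v ∈ P.submodule, eval v F = 0}

/-- The affine cone in `k^(n+1)` over a subset of `ℙⁿ(k)`. -/
def affineCone (V : Set (ℙ k (Fin (n + 1) → k))) : Set (Fin (n + 1) → k) :=
  {v | ∃ P ∈ V, v ∈ P.submodule}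

/-- The ideal of all polynomials that vanish at every representative of every point of `V`;
over an infinite field this is the homogeneous ideal of `V`. -/
noncomputable def projIdeal (V : Set (ℙ k (Fin (n + 1) → k))) :
    Ideal (MvPolynomial (Fin (n + 1)) k) :=
  vanishingIdeal k (affineCone V)

/-- The homogeneous coordinate ring of `V`. -/
abbrev HomogCoordRing (V : Set (ℙ k (Fin (n + 1) → k))) : Type _ :=
  MvPolynomial (Fin (n + 1)) k ⧸ projIdeal V

/-- The function field of an irreducible projective algebraic set `V`: the subfield
`k(xᵢ / xⱼ : xⱼ ≠ 0)` of the fraction field of the homogeneous coordinate ring (the indices `j`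
with `xⱼ = 0` only contribute the element `0`). -/
noncomputable def projFunctionField (V : Set (ℙ k (Fin (n + 1) → k))) [(projIdeal V).IsPrime] :
    IntermediateField k (FractionRing (HomogCoordRing V)) :=
  IntermediateField.adjoin k
    {w | ∃ i j : Fin (n + 1),
      w = algebraMap (HomogCoordRing V) (FractionRing (HomogCoordRing V))
            (Ideal.Quotient.mk (projIdeal V) (X i)) /
          algebraMap (HomogCoordRing V) (FractionRing (HomogCoordRing V))
            (Ideal.Quotient.mk (projIdeal V) (X j))}

end Projective

/-! ### The geometric genus -/

/-- The differentials of a function field `F/k` that are regular at every place: for each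
valuation ring `O` of `F` containing `k`, `ω` lies in the image of `Ω[O⁄k]` in `Ω[F⁄k]`, that is,
`ω` is a sum of terms `x dy` with `x, y ∈ O`. If `F` is the function field of a curve over an
algebraically closed field, the rings `O ≠ F` are the local rings of its smooth projective model,
and these are the global regular differentials of that model. -/
noncomputable def regularDifferentials (k F : Type*) [Field k] [Field F] [Algebra k F] :
    Submodule k (Ω[F⁄k]) :=
  ⨅ (O : ValuationSubring F) (_ : ∀ c : k, algebraMap k F c ∈ O),
    Submodule.span k {ω | ∃ x ∈ O, ∃ y ∈ O, ω = x • KaehlerDifferential.D k F y}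

/-- `V ⊆ ℙⁿ(k)` (with `k` algebraically closed) is an irreducible projective curve of geometric
genus `g`: its ideal is prime, its function field has transcendence degree one, and the regular
differentials of its function field (those of the normalization of `V`) form a vector space of
dimension `g`. -/
def IsIrreducibleCurveOfGenus {k : Type*} [Field k] {n : ℕ}
    (V : Set (ℙ k (Fin (n + 1) → k))) (g : ℕ) : Prop :=
  ∃ _ : (projIdeal V).IsPrime,
    Algebra.trdeg k (projFunctionField V) = 1 ∧
    Module.rank k (regularDifferentials k (projFunctionField V)) = (g : Cardinal)

/-! ### The 224 curve -/

/-- The fiber over `a` of the 224 surface, in `ℙ⁴` with homogeneous coordinates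
`(q : r : s : t : z) = (X 0 : X 1 : X 2 : X 3 : X 4)`. -/
noncomputable def C224 {k : Type*} [Field k] (a : k) : Set (ℙ k (Fin (4 + 1) → k)) :=
  let q : MvPolynomial (Fin (4 + 1)) k := X 0
  let r : MvPolynomial (Fin (4 + 1)) k := X 1
  let s : MvPolynomial (Fin (4 + 1)) k := X 2
  let t : MvPolynomial (Fin (4 + 1)) k := X 3
  let z : MvPolynomial (Fin (4 + 1)) k := X 4
  projZeroLocus
    {C a * z ^ 2 - t ^ 2 - (t * z - s ^ 2),
     C a * z ^ 2 - t ^ 2 - (s * z - q ^ 2),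
     C a * z ^ 2 - t ^ 2 - (-(s * z) - r ^ 2)}

-- Each of these curves has a function field of the form `k(w, √f, √g)` with `f g` squarefree, and
-- for such fields the regular differentials can be written down explicitly.
--
-- The Galois group `(ℤ/2)²` over `k(w)` splits a differential into four parts `(n/d)√h dw` with `h
-- ∈ {1, f, g, fg}`, and regularity can be tested on each part separately. A part is regular exactly
-- when it is `p dw/√h` with `deg p < (deg h - 1)/2`. The genus is therefore the sum of `⌊(deg h -
-- 1)/2⌋` over `h = f, g, fg`: degrees `3, 3, 6` give `1 + 1 + 2 = 4`, and degrees `2, 2, 4` give `0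
-- + 0 + 1 = 1`. For necessity one embeds the field in `k((T))` by `w = c + T²` and `w = T⁻²` and
-- reads off orders (`pos_orderTop_components`, `exists_polynomial_of_pos_orderTop`). For
-- sufficiency one argues in an arbitrary valuation ring (`div_smul_D_mem_regularDifferentials`).
--
-- Irreducibility comes from a generic point. Modulo the three quadrics every polynomial is a
-- combination of `1, s, q, r, qr, sq, sr, sqr` over `k[t, z]`. If these eight are independent at a
-- point with coordinates in some extension field, the homogeneous ideal is the kernel of evaluation
-- along the line through that point, hence prime (`projIdeal_C224_isPrime`).
--
-- The parametrizations: on `z = 1` the first equation is the conic `s² = t² + t - a`. For `a = 0`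
-- the slope `w = s/t` at the origin gives `t = 1/(w² - 1)`, `(q/t)² = w³ - w + 1` and `(r/t)² = -w³
-- + w + 1`. For critical `a` use `w = s - t`. Put `γ = a - t²`; then `s² = t - γ`, `q² = s - γ`,
-- `r² = -s - γ`, so `q = 0` or `r = 0` means `s = ±γ` and `f_γ³(0) = a`. A double root `c` of that
-- equation becomes a double root of the quartics in `w` representing `q²` and `r²`, at `w = -c²`
-- and `w = -c² - 2c`. Removing these squares leaves two quadratics.

universe u

/-! ### Laurent series -/

namespace LaurentSeries

open HahnSeries

variable {k : Type u} [Field k]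

/-- Constants as the scalars of the Laurent series; this takes precedence over the algebra
structure obtained from the one on power series, which is not reducibly equal to it. -/
noncomputable instance instAlgebraConstants : Algebra k (LaurentSeries k) :=
  HahnSeries.instAlgebra

/-- The Euler operator `T d/dT` on Laurent series. -/
def euler (x : LaurentSeries k) : LaurentSeries k where
  coeff := fun n => (n : k) * x.coeff n
  isPWO_support' := x.isPWO_support.mono fun n hn => by
    simp only [Function.mem_support, ne_eq, mul_eq_zero, not_or] at hn
    exact hn.2

theorem support_euler_subset (x : LaurentSeries k) : (euler x).support ⊆ x.support :=
  fun n hn => by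
    simp only [HahnSeries.mem_support, euler, ne_eq, mul_eq_zero, not_or] at hn
    exact hn.2

/-- Coefficientwise this is `n = i + j` for the terms of the convolution contributing to degree `n`.
-/
theorem euler_mul (x y : LaurentSeries k) : euler (x * y) = x * euler y + y * euler x := by
  ext n
  rw [HahnSeries.coeff_add, coeff_mul_right' y.isPWO_support (support_euler_subset y),
    mul_comm y, coeff_mul_left' x.isPWO_support (support_euler_subset x),
    ← Finset.sum_add_distrib]
  simp only [euler]
  rw [HahnSeries.coeff_mul, Finset.mul_sum]
  refine Finset.sum_congr rfl fun ij hij => ?_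
  rw [Finset.mem_antidiagonal] at hij
  rw [← hij.2.2]
  push_cast
  ring

/-- The Euler derivation `T d/dT` of the field of Laurent series. -/
noncomputable def eulerDerivation (k : Type u) [Field k] :
    Derivation k (LaurentSeries k) (LaurentSeries k) :=
  Derivation.mk'
    { toFun := euler
      map_add' := fun x y => by
        ext n
        simp [euler, mul_add]
      map_smul' := fun c x => by
        ext n
        simp [euler, mul_left_comm] }
    euler_mul

theorem eulerDerivation_coeff (x : LaurentSeries k) (n : ℤ) :
    (eulerDerivation k x).coeff n = n * x.coeff n := rfl

theorem eulerDerivation_single (n : ℤ) (c : k) :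
    eulerDerivation k (single n c) = single n ((n : k) * c) := by
  ext m
  rw [eulerDerivation_coeff]
  by_cases h : m = n
  · subst h; simp
  · simp [coeff_single_of_ne h]

/-- The ring of power series as a valuation subring of the Laurent series. -/
noncomputable def integralSubring (k : Type u) [Field k] : ValuationSubring (LaurentSeries k) :=
  (AddValuation.toValuation (HahnSeries.addVal ℤ k)).valuationSubring

theorem mem_integralSubring {x : LaurentSeries k} :
    x ∈ integralSubring k ↔ 0 ≤ x.orderTop := by
  rw [← HahnSeries.addVal_apply]
  exact Iff.rfl

/-- The factor `n` kills the constant term. This is why `T d/dT` serves as the test: a form `x dy`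
with `x, y` integral gets strictly positive order. -/
theorem orderTop_eulerDerivation {x : LaurentSeries k} (hx : 0 ≤ x.orderTop) :
    0 < (eulerDerivation k x).orderTop := by
  by_contra! h
  obtain ⟨n, hn⟩ : ∃ n : ℤ, (eulerDerivation k x).orderTop = n :=
    (WithTop.ne_top_iff_exists.mp (ne_top_of_le_ne_top (by simp) h)).imp fun _ h => h.symm
  have h0 : (eulerDerivation k x).coeff n ≠ 0 := coeff_orderTop_ne hn
  rw [hn] at h
  rw [eulerDerivation_coeff] at h0
  have hn0 : n ≠ 0 := by
    rintro rfl
    simp at h0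
  have hn1 : n ≤ 0 := by exact_mod_cast h
  have h2 : x.orderTop ≤ n := orderTop_le_of_coeff_ne_zero (right_ne_zero_of_mul h0)
  have : (0 : ℤ) ≤ n := by exact_mod_cast hx.trans h2
  omega

theorem orderTop_mul' (x y : LaurentSeries k) :
    (x * y).orderTop = x.orderTop + y.orderTop := by
  simp only [← HahnSeries.addVal_apply, AddValuation.map_mul]

theorem pos_orderTop_iff {x : LaurentSeries k} (hx : x ≠ 0) : 0 < x.orderTop ↔ 0 < x.order := by
  rw [← order_eq_orderTop_of_ne_zero hx]
  exact_mod_cast Iff.rfl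

variable [CharZero k]

/-- The root is the binomial series `(1 + X)^(1/2)` evaluated at `X = p - 1`. -/
theorem _root_.PowerSeries.exists_sq_of_constantCoeff_eq_one (p : PowerSeries k)
    (hp : PowerSeries.constantCoeff p = 1) : ∃ u, u ^ 2 = p := by
  have hs : PowerSeries.HasSubst (p - 1) :=
    PowerSeries.HasSubst.of_constantCoeff_zero' (by simp [hp])
  have h2 : (PowerSeries.binomialSeries k (1 / 2 : ℚ)) ^ 2 = 1 + PowerSeries.X := by
    have h := PowerSeries.binomialSeries_nat (R := ℚ) (A := k) 1
    rw [sq, ← PowerSeries.binomialSeries_add]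
    norm_num at h ⊢
    exact h
  refine ⟨PowerSeries.substAlgHom (R := k) hs (PowerSeries.binomialSeries k (1 / 2 : ℚ)), ?_⟩
  rw [← map_pow, h2, map_add, map_one, PowerSeries.substAlgHom_X]
  ring

theorem exists_sq_of_even_order [IsAlgClosed k] {x : LaurentSeries k} (hx : x ≠ 0) {n : ℤ}
    (hn : x.order = 2 * n) : ∃ y, y ^ 2 = x := by
  set p := x.powerSeriesPart
  have ha : PowerSeries.constantCoeff p ≠ 0 := by
    rw [← PowerSeries.coeff_zero_eq_constantCoeff_apply, powerSeriesPart_coeff]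
    simpa using coeff_order_eq_zero.not.mpr hx
  set a := PowerSeries.constantCoeff p
  obtain ⟨b, hb⟩ := IsAlgClosed.exists_pow_nat_eq a (n := 2) (by norm_num)
  obtain ⟨v, hv⟩ := PowerSeries.exists_sq_of_constantCoeff_eq_one (PowerSeries.C a⁻¹ * p)
    (by simp [a, ha])
  refine ⟨single n b * ofPowerSeries ℤ k v, ?_⟩
  rw [mul_pow, ← map_pow (ofPowerSeries ℤ k), hv, map_mul, ofPowerSeries_C, single_pow,
    HahnSeries.C_apply, ← mul_assoc, single_mul_single, hb, mul_inv_cancel₀ ha, add_zero,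
    ← single_order_mul_powerSeriesPart x, hn]
  simp [p]

-- Split off `(X - c)^m`: the cofactor does not vanish at `c`, so its value at `c + z` is a unit of
-- the power series ring.
omit [CharZero k] in
theorem order_aeval_algebraMap_add (c : k) {z : LaurentSeries k} (hz : 0 < z.order)
    {p : Polynomial k} (hp : p ≠ 0) :
    Polynomial.aeval (algebraMap k (LaurentSeries k) c + z) p ≠ 0 ∧
    (Polynomial.aeval (algebraMap k (LaurentSeries k) c + z) p).order =
      p.rootMultiplicity c * z.order := by
  have hz0 : z ≠ 0 := by
    rintro rfl
    simp at hz
  have hzt : 0 < z.orderTop := (pos_orderTop_iff hz0).2 hz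
  set w := algebraMap k (LaurentSeries k) c + z with hw
  have hC : ∀ e : k, algebraMap k (LaurentSeries k) e ∈ integralSubring k := fun e => by
    rw [mem_integralSubring]
    rcases eq_or_ne e 0 with rfl | he
    · simp
    · exact (orderTop_single he).ge
  have hwO : w ∈ integralSubring k :=
    add_mem (hC c) (mem_integralSubring.2 hzt.le)
  have hO : ∀ q : Polynomial k, Polynomial.aeval w q ∈ integralSubring k := fun q => by
    rw [Polynomial.aeval_eq_sum_range]
    exact sum_mem fun i _ => by
      rw [Algebra.smul_def]
      exact mul_mem (hC _) (pow_mem hwO _)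
  have key : ∀ q : Polynomial k, q.eval c ≠ 0 →
      Polynomial.aeval w q ≠ 0 ∧ (Polynomial.aeval w q).order = 0 := by
    intro q hq
    have h0 : (Polynomial.aeval w q).orderTop = 0 := by
      have h1 : q = Polynomial.C (q.eval c) + (Polynomial.X - Polynomial.C c) *
          (q /ₘ (Polynomial.X - Polynomial.C c)) := by
        rw [← Polynomial.modByMonic_X_sub_C_eq_C_eval]
        exact (Polynomial.modByMonic_add_div q _).symm
      have h2 : Polynomial.aeval w (Polynomial.X - Polynomial.C c) = z := by
        simp [hw]
      have hc : (algebraMap k (LaurentSeries k) (q.eval c)).orderTop = 0 := by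
        exact orderTop_single hq
      rw [h1, map_add, map_mul, h2, Polynomial.aeval_C, orderTop_add_eq_left, hc]
      rw [hc, orderTop_mul']
      exact hzt.trans_le (le_add_of_nonneg_right (mem_integralSubring.1 (hO _)))
    have h3 : Polynomial.aeval w q ≠ 0 := fun h => by simp [h] at h0
    refine ⟨h3, ?_⟩
    rw [← order_eq_orderTop_of_ne_zero h3] at h0
    exact_mod_cast h0
  have hq : p = (Polynomial.X - Polynomial.C c) ^ p.rootMultiplicity c *
      (p /ₘ (Polynomial.X - Polynomial.C c) ^ p.rootMultiplicity c) :=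
    (Polynomial.pow_mul_divByMonic_rootMultiplicity_eq p c).symm
  obtain ⟨h1, h2⟩ := key _ (Polynomial.eval_divByMonic_pow_rootMultiplicity_ne_zero c hp)
  have h3 : Polynomial.aeval w p = z ^ p.rootMultiplicity c *
      Polynomial.aeval w (p /ₘ (Polynomial.X - Polynomial.C c) ^ p.rootMultiplicity c) := by
    conv_lhs => rw [hq]
    simp [hw]
  rw [h3]
  refine ⟨mul_ne_zero (pow_ne_zero _ hz0) h1, ?_⟩
  rw [order_mul (pow_ne_zero _ hz0) h1, order_pow, h2, add_zero, nsmul_eq_mul]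

-- The reversed polynomial has nonzero constant term, so its value at `z` has order `0`; the pole
-- comes entirely from `z ^ (-deg p)`.
omit [CharZero k] in
theorem order_aeval_inv {z : LaurentSeries k} (hz : 0 < z.order) {p : Polynomial k}
    (hp : p ≠ 0) :
    Polynomial.aeval z⁻¹ p ≠ 0 ∧ (Polynomial.aeval z⁻¹ p).order = -(p.natDegree * z.order) := by
  have hz0 : z ≠ 0 := by
    rintro rfl
    simp at hz
  have hr : p.reverse ≠ 0 := by simpa using hp
  obtain ⟨h1, h2⟩ := order_aeval_algebraMap_add 0 hz hr
  rw [map_zero, zero_add] at h1 h2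
  have h3 : p.reverse.rootMultiplicity 0 = 0 := by
    apply Polynomial.rootMultiplicity_eq_zero
    simpa [Polynomial.IsRoot, ← Polynomial.coeff_zero_eq_eval_zero] using hp
  rw [h3, Nat.cast_zero, zero_mul] at h2
  have h4 : Polynomial.aeval z⁻¹ p * z ^ p.natDegree = Polynomial.aeval z p.reverse := by
    let : Invertible z⁻¹ := ⟨z, mul_inv_cancel₀ hz0, inv_mul_cancel₀ hz0⟩
    have h := Polynomial.eval₂_reverse_mul_pow (algebraMap k (LaurentSeries k)) z⁻¹ p
    change Polynomial.aeval z p.reverse * _ = Polynomial.aeval z⁻¹ p at h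
    rw [← h, mul_assoc, ← mul_pow, inv_mul_cancel₀ hz0, one_pow, mul_one]
  have h5 : Polynomial.aeval z⁻¹ p ≠ 0 := fun h => h1 (by rw [← h4, h, zero_mul])
  refine ⟨h5, ?_⟩
  have h6 := congrArg HahnSeries.order h4
  rw [order_mul h5 (pow_ne_zero _ hz0), order_pow, h2, nsmul_eq_mul] at h6
  linarith

end LaurentSeries

/-! ### Biquadratic function fields -/

section Biquadratic

open IntermediateField
open scoped IntermediateField.algebraAdjoinAdjoin

theorem add_mul_eq_zero_of_sq_ne {k K : Type*} [Field k] [Field K] [Algebra k K]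
    {E : IntermediateField k K} {A : K} (hA : ∀ u ∈ E, u ^ 2 ≠ A ^ 2) {e₀ e₁ : K}
    (h₀ : e₀ ∈ E) (h₁ : e₁ ∈ E) (h : e₀ + e₁ * A = 0) : e₀ = 0 ∧ e₁ = 0 := by
  have h1 : e₁ = 0 := by
    by_contra h1
    refine hA (-e₀ / e₁) (div_mem (neg_mem h₀) h₁) ?_
    have : -e₀ / e₁ = A := by
      field_simp
      linear_combination -h
    rw [this]
  subst h1
  simpa using h

/-- `w` is transcendental, `A = √f(w)` and `B = √g(w)`. -/
structure IsBiquadratic {k K : Type*} [Field k] [Field K] [Algebra k K] (f g : Polynomial k)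
    (w A B : K) : Prop where
  transcendental : Transcendental k w
  sq_left : A ^ 2 = Polynomial.aeval w f
  sq_right : B ^ 2 = Polynomial.aeval w g

/-- The combinations of `1, A, B, AB` with coefficients in `E`. -/
def IsBiquadraticComb {k K : Type*} [Field k] [Field K] [Algebra k K]
    (E : IntermediateField k K) (A B x : K) : Prop :=
  ∃ e₀ ∈ E, ∃ e₁ ∈ E, ∃ e₂ ∈ E, ∃ e₃ ∈ E, x = e₀ + e₁ * A + e₂ * B + e₃ * (A * B)

namespace IsBiquadraticComb

variable {k K : Type*} [Field k] [Field K] [Algebra k K] {E : IntermediateField k K} {A B : K}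

theorem of_mem {x : K} (hx : x ∈ E) : IsBiquadraticComb E A B x :=
  ⟨x, hx, 0, zero_mem _, 0, zero_mem _, 0, zero_mem _, by ring⟩

theorem add {x y : K} : IsBiquadraticComb E A B x → IsBiquadraticComb E A B y →
    IsBiquadraticComb E A B (x + y) := by
  rintro ⟨a₀, h₀, a₁, h₁, a₂, h₂, a₃, h₃, rfl⟩ ⟨b₀, i₀, b₁, i₁, b₂, i₂, b₃, i₃, rfl⟩
  exact ⟨_, add_mem h₀ i₀, _, add_mem h₁ i₁, _, add_mem h₂ i₂, _, add_mem h₃ i₃, by ring⟩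

theorem mul (hA : A ^ 2 ∈ E) (hB : B ^ 2 ∈ E) {x y : K} : IsBiquadraticComb E A B x →
    IsBiquadraticComb E A B y → IsBiquadraticComb E A B (x * y) := by
  rintro ⟨a₀, h₀, a₁, h₁, a₂, h₂, a₃, h₃, rfl⟩ ⟨b₀, i₀, b₁, i₁, b₂, i₂, b₃, i₃, rfl⟩
  exact ⟨a₀ * b₀ + a₁ * b₁ * A ^ 2 + a₂ * b₂ * B ^ 2 + a₃ * b₃ * (A ^ 2 * B ^ 2),
    by apply_rules [add_mem, sub_mem, mul_mem, neg_mem],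
    a₀ * b₁ + a₁ * b₀ + (a₂ * b₃ + a₃ * b₂) * B ^ 2,
    by apply_rules [add_mem, sub_mem, mul_mem, neg_mem],
    a₀ * b₂ + a₂ * b₀ + (a₁ * b₃ + a₃ * b₁) * A ^ 2,
    by apply_rules [add_mem, sub_mem, mul_mem, neg_mem],
    a₀ * b₃ + a₁ * b₂ + a₂ * b₁ + a₃ * b₀, by apply_rules [add_mem, sub_mem, mul_mem, neg_mem],
    by ring⟩

end IsBiquadraticComb

/-- Kummer theory for two square roots: a relation involving `B` puts `B = u + vA` in `E(A)`;
squaring forces `uv = 0`, so that `B` or `AB` lies in `E`. -/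
theorem biquadratic_independent {k K : Type*} [Field k] [Field K] [Algebra k K] [CharZero K]
    {E : IntermediateField k K} {A B : K} (hA : A ^ 2 ∈ E) (hB : B ^ 2 ∈ E)
    (hA' : ∀ u ∈ E, u ^ 2 ≠ A ^ 2) (hB' : ∀ u ∈ E, u ^ 2 ≠ B ^ 2)
    (hAB : ∀ u ∈ E, u ^ 2 ≠ (A * B) ^ 2) {e₀ e₁ e₂ e₃ : K} (h₀ : e₀ ∈ E) (h₁ : e₁ ∈ E)
    (h₂ : e₂ ∈ E) (h₃ : e₃ ∈ E) (h : e₀ + e₁ * A + e₂ * B + e₃ * (A * B) = 0) :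
    e₀ = 0 ∧ e₁ = 0 ∧ e₂ = 0 ∧ e₃ = 0 := by
  by_cases hQ : e₂ + e₃ * A = 0
  · have hP : e₀ + e₁ * A = 0 := by linear_combination h - B * hQ
    obtain ⟨h1, h2⟩ := add_mul_eq_zero_of_sq_ne hA' h₀ h₁ hP
    obtain ⟨h3, h4⟩ := add_mul_eq_zero_of_sq_ne hA' h₂ h₃ hQ
    exact ⟨h1, h2, h3, h4⟩
  exfalso
  have hQ' : e₂ - e₃ * A ≠ 0 := fun hQ' => by
    obtain ⟨h3, h4⟩ := add_mul_eq_zero_of_sq_ne hA' h₂ (neg_mem h₃)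
      (show e₂ + -e₃ * A = 0 by linear_combination hQ')
    rw [neg_eq_zero] at h4
    exact hQ (by rw [h3, h4]; ring)
  -- The norm of `e₂ + e₃ A` over `E`, the common denominator when solving the relation for `B`.
  set N := e₂ * e₂ - e₃ * e₃ * A ^ 2 with hN
  have hN0 : N ≠ 0 := by
    have : N = (e₂ + e₃ * A) * (e₂ - e₃ * A) := by rw [hN]; ring
    rw [this]
    exact mul_ne_zero hQ hQ'
  have hNE : N ∈ E := by apply_rules [add_mem, sub_mem, mul_mem, neg_mem]
  obtain ⟨u, hu, v, hv, huv⟩ : ∃ u ∈ E, ∃ v ∈ E, B = u + v * A := by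
    refine ⟨-(e₀ * e₂ - e₁ * e₃ * A ^ 2) / N,
      div_mem (by apply_rules [add_mem, sub_mem, mul_mem, neg_mem]) hNE,
      -(e₁ * e₂ - e₀ * e₃) / N,
      div_mem (by apply_rules [add_mem, sub_mem, mul_mem, neg_mem]) hNE, ?_⟩
    field_simp
    rw [hN]
    linear_combination (e₂ - e₃ * A) * h
  obtain ⟨h1, h2⟩ := add_mul_eq_zero_of_sq_ne hA'
    (show u * u + v * v * A ^ 2 - B ^ 2 ∈ E by apply_rules [add_mem, sub_mem, mul_mem, neg_mem])
    (show 2 * (u * v) ∈ E from mul_mem (ofNat_mem E 2) (mul_mem hu hv)) (by rw [huv]; ring)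
  rcases mul_eq_zero.1 ((mul_eq_zero.1 h2).resolve_left two_ne_zero) with rfl | rfl
  · exact hAB (v * A ^ 2) (mul_mem hv hA) (by rw [huv]; ring)
  · exact hB' u hu (by rw [huv]; ring)

/-- Rationalize the denominator twice: multiplying by the conjugate under `B ↦ -B` lands in `E(A)`,
and then the conjugate under `A ↦ -A` lands in `E`. -/
theorem biquadratic_comb_inv {k K : Type*} [Field k] [Field K] [Algebra k K] [CharZero K]
    {E : IntermediateField k K} {A B : K} (hA : A ^ 2 ∈ E) (hB : B ^ 2 ∈ E)
    (hA' : ∀ u ∈ E, u ^ 2 ≠ A ^ 2) (hB' : ∀ u ∈ E, u ^ 2 ≠ B ^ 2)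
    (hAB : ∀ u ∈ E, u ^ 2 ≠ (A * B) ^ 2) {x : K} (hx : IsBiquadraticComb E A B x) :
    IsBiquadraticComb E A B x⁻¹ := by
  rcases eq_or_ne x 0 with rfl | hx0
  · simpa using hx
  obtain ⟨e₀, h₀, e₁, h₁, e₂, h₂, e₃, h₃, rfl⟩ := hx
  set n₀ := e₀ * e₀ + e₁ * e₁ * A ^ 2 - (e₂ * e₂ + e₃ * e₃ * A ^ 2) * B ^ 2 with hn₀
  set n₁ := (e₀ * e₁ + e₀ * e₁) - (e₂ * e₃ + e₂ * e₃) * B ^ 2 with hn₁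
  have hn₀E : n₀ ∈ E := by apply_rules [add_mem, sub_mem, mul_mem, neg_mem]
  have hn₁E : n₁ ∈ E := by apply_rules [add_mem, sub_mem, mul_mem, neg_mem]
  set y := e₀ + e₁ * A - e₂ * B - e₃ * (A * B) with hy
  have hy0 : y ≠ 0 := fun h => by
    obtain ⟨r0, r1, r2, r3⟩ := biquadratic_independent hA hB hA' hB' hAB h₀ h₁ (neg_mem h₂)
      (neg_mem h₃) (show e₀ + e₁ * A + -e₂ * B + -e₃ * (A * B) = 0 by rw [← h, hy]; ring)
    rw [neg_eq_zero] at r2 r3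
    exact hx0 (by rw [r0, r1, r2, r3]; ring)
  have hN1 : (e₀ + e₁ * A + e₂ * B + e₃ * (A * B)) * y = n₀ + n₁ * A := by
    rw [hy, hn₀, hn₁]; ring
  have hN10 : n₀ + n₁ * A ≠ 0 := hN1 ▸ mul_ne_zero hx0 hy0
  have hN20 : n₀ - n₁ * A ≠ 0 := fun h => by
    obtain ⟨r0, r1⟩ := add_mul_eq_zero_of_sq_ne hA' hn₀E (neg_mem hn₁E)
      (show n₀ + -n₁ * A = 0 by rw [← h]; ring)
    rw [neg_eq_zero] at r1
    exact hN10 (by rw [r0, r1]; ring)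
  set N := n₀ * n₀ - n₁ * n₁ * A ^ 2 with hN
  have hNE : N ∈ E := by apply_rules [add_mem, sub_mem, mul_mem, neg_mem]
  have hNf : N = (n₀ + n₁ * A) * (n₀ - n₁ * A) := by rw [hN]; ring
  have hN0 : N ≠ 0 := hNf ▸ mul_ne_zero hN10 hN20
  have hinv : (e₀ + e₁ * A + e₂ * B + e₃ * (A * B))⁻¹ = y * ((n₀ - n₁ * A) * N⁻¹) := by
    apply inv_eq_of_mul_eq_one_right
    rw [← mul_assoc, ← mul_assoc, hN1, ← hNf, mul_inv_cancel₀ hN0]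
  rw [hinv]
  refine IsBiquadraticComb.mul hA hB ⟨e₀, h₀, e₁, h₁, -e₂, neg_mem h₂, -e₃, neg_mem h₃, ?_⟩
    (IsBiquadraticComb.mul hA hB ⟨n₀, hn₀E, -n₁, neg_mem hn₁E, 0, zero_mem _, 0, zero_mem _, ?_⟩
      (IsBiquadraticComb.of_mem (inv_mem hNE)))
  · rw [hy]; ring
  · ring

/-- In `n² = h d²` a root of `h` would have even multiplicity on the left and odd multiplicity on
the right. -/
theorem sq_ne_aeval_of_separable {k K : Type*} [Field k] [IsAlgClosed k] [Field K] [Algebra k K]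
    {w : K} (hw : Transcendental k w) {h : Polynomial k} (hs : h.Separable)
    (hd : 0 < h.natDegree) {u : K} (hu : u ∈ k⟮w⟯) : u ^ 2 ≠ Polynomial.aeval w h := by
  intro hsq
  have hinj := transcendental_iff_injective.1 hw
  have h0 : h ≠ 0 := by
    rintro rfl
    simp at hd
  obtain ⟨n, d, rfl⟩ := (mem_adjoin_simple_iff k u).1 hu
  have hh : Polynomial.aeval w h ≠ 0 := fun e => h0 (hinj (by rw [e, map_zero]))
  have hd0 : Polynomial.aeval w d ≠ 0 := fun e => hh (by rw [← hsq, e]; simp)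
  have hd0' : d ≠ 0 := by
    rintro rfl
    simp at hd0
  have heq : n ^ 2 = h * d ^ 2 := hinj (by
    rw [map_mul, map_pow, map_pow, ← hsq]
    field_simp)
  obtain ⟨c, hc⟩ := IsAlgClosed.exists_root h
    (by rw [Polynomial.degree_eq_natDegree h0]; exact_mod_cast hd.ne')
  have h1 : h.rootMultiplicity c = 1 :=
    le_antisymm (Polynomial.rootMultiplicity_le_one_of_separable hs c)
      ((Polynomial.rootMultiplicity_pos h0).2 hc)
  have hn0 : n ^ 2 ≠ 0 := heq ▸ mul_ne_zero h0 (pow_ne_zero _ hd0')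
  have h2 := congrArg (Polynomial.rootMultiplicity c) heq
  rw [Polynomial.rootMultiplicity_mul (heq ▸ hn0), h1, sq, sq, Polynomial.rootMultiplicity_mul,
    Polynomial.rootMultiplicity_mul] at h2
  · omega
  · exact mul_self_ne_zero.2 hd0'
  · rwa [sq] at hn0

namespace IsBiquadratic

section

variable {k K : Type*} [Field k] [Field K] [Algebra k K]
  {f g : Polynomial k} {w A B : K}

theorem aeval_mem (w : K) (p : Polynomial k) : Polynomial.aeval w p ∈ k⟮w⟯ :=
  (mem_adjoin_simple_iff k _).2 ⟨p, 1, by simp⟩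

theorem sq_left_mem (h : IsBiquadratic f g w A B) : A ^ 2 ∈ k⟮w⟯ :=
  h.sq_left ▸ (mem_adjoin_simple_iff k _).2 ⟨f, 1, by simp⟩

theorem sq_right_mem (h : IsBiquadratic f g w A B) : B ^ 2 ∈ k⟮w⟯ :=
  h.sq_right ▸ (mem_adjoin_simple_iff k _).2 ⟨g, 1, by simp⟩

theorem mul_sq (h : IsBiquadratic f g w A B) : (A * B) ^ 2 = Polynomial.aeval w (f * g) := by
  rw [mul_pow, h.sq_left, h.sq_right, map_mul]

variable [IsAlgClosed k]

theorem sq_ne_left (h : IsBiquadratic f g w A B) (hs : (f * g).Separable)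
    (hf : 0 < f.natDegree) : ∀ u ∈ k⟮w⟯, u ^ 2 ≠ A ^ 2 := fun _ hu =>
  h.sq_left ▸ sq_ne_aeval_of_separable h.transcendental hs.of_mul_left hf hu

theorem sq_ne_right (h : IsBiquadratic f g w A B) (hs : (f * g).Separable)
    (hg : 0 < g.natDegree) : ∀ u ∈ k⟮w⟯, u ^ 2 ≠ B ^ 2 := fun _ hu =>
  h.sq_right ▸ sq_ne_aeval_of_separable h.transcendental hs.of_mul_right hg hu

theorem sq_ne_mul (h : IsBiquadratic f g w A B) (hs : (f * g).Separable)
    (hf : 0 < f.natDegree) (hg : 0 < g.natDegree) : ∀ u ∈ k⟮w⟯, u ^ 2 ≠ (A * B) ^ 2 :=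
  fun _ hu => h.mul_sq ▸ sq_ne_aeval_of_separable h.transcendental hs
    (by
      rw [Polynomial.natDegree_mul]
      · omega
      · rintro rfl; simp at hf
      · rintro rfl; simp at hg) hu

variable [CharZero K]

theorem independent (h : IsBiquadratic f g w A B) (hs : (f * g).Separable)
    (hf : 0 < f.natDegree) (hg : 0 < g.natDegree) {e₀ e₁ e₂ e₃ : K} (h₀ : e₀ ∈ k⟮w⟯)
    (h₁ : e₁ ∈ k⟮w⟯) (h₂ : e₂ ∈ k⟮w⟯) (h₃ : e₃ ∈ k⟮w⟯)
    (he : e₀ + e₁ * A + e₂ * B + e₃ * (A * B) = 0) :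
    e₀ = 0 ∧ e₁ = 0 ∧ e₂ = 0 ∧ e₃ = 0 :=
  biquadratic_independent h.sq_left_mem h.sq_right_mem (h.sq_ne_left hs hf)
    (h.sq_ne_right hs hg) (h.sq_ne_mul hs hf hg) h₀ h₁ h₂ h₃ he

theorem polynomial_independent (h : IsBiquadratic f g w A B) (hs : (f * g).Separable)
    (hf : 0 < f.natDegree) (hg : 0 < g.natDegree) {p₀ p₁ p₂ p₃ : Polynomial k}
    (he : Polynomial.aeval w p₀ + Polynomial.aeval w p₁ * A + Polynomial.aeval w p₂ * B +
      Polynomial.aeval w p₃ * (A * B) = 0) :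
    p₀ = 0 ∧ p₁ = 0 ∧ p₂ = 0 ∧ p₃ = 0 := by
  have hinj := transcendental_iff_injective.1 h.transcendental
  obtain ⟨h0, h1, h2, h3⟩ := h.independent hs hf hg (aeval_mem w _) (aeval_mem w _)
    (aeval_mem w _) (aeval_mem w _) he
  exact ⟨hinj (by simpa using h0), hinj (by simpa using h1), hinj (by simpa using h2),
    hinj (by simpa using h3)⟩

theorem comb_of_mem_adjoin (h : IsBiquadratic f g w A B) (hs : (f * g).Separable)
    (hf : 0 < f.natDegree) (hg : 0 < g.natDegree) {x : K} (hx : x ∈ adjoin k {w, A, B}) :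
    IsBiquadraticComb k⟮w⟯ A B x := by
  induction hx using IntermediateField.adjoin_induction with
  | mem x hx =>
    rcases hx with rfl | rfl | rfl
    · exact .of_mem (mem_adjoin_simple_self k _)
    · exact ⟨0, zero_mem _, 1, one_mem _, 0, zero_mem _, 0, zero_mem _, by ring⟩
    · exact ⟨0, zero_mem _, 0, zero_mem _, 1, one_mem _, 0, zero_mem _, by ring⟩
  | algebraMap x => exact .of_mem (_root_.algebraMap_mem _ x)
  | add x y _ _ hx hy => exact hx.add hy
  | mul x y _ _ hx hy => exact .mul h.sq_left_mem h.sq_right_mem hx hy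
  | inv x _ hx =>
    exact biquadratic_comb_inv h.sq_left_mem h.sq_right_mem (h.sq_ne_left hs hf)
      (h.sq_ne_right hs hg) (h.sq_ne_mul hs hf hg) hx

end

/-- The `pᵢ` are chosen before the field `K`. With independence of `1, A, B, AB`, this shows that
which polynomials vanish at `(w, A, B)` depends only on `f` and `g`. -/
theorem exists_reduced_form {k : Type u} [Field k] (f g : Polynomial k)
    (p : MvPolynomial (Fin 3) k) : ∃ p₀ p₁ p₂ p₃ : Polynomial k,
    ∀ {K : Type u} [Field K] [Algebra k K] {w A B : K}, A ^ 2 = Polynomial.aeval w f →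
      B ^ 2 = Polynomial.aeval w g → MvPolynomial.aeval ![w, A, B] p =
        Polynomial.aeval w p₀ + Polynomial.aeval w p₁ * A + Polynomial.aeval w p₂ * B +
          Polynomial.aeval w p₃ * (A * B) := by
  induction p using MvPolynomial.induction_on with
  | C a => exact ⟨Polynomial.C a, 0, 0, 0, fun _ _ => by simp⟩
  | add p q hp hq =>
    obtain ⟨p₀, p₁, p₂, p₃, hp⟩ := hp
    obtain ⟨q₀, q₁, q₂, q₃, hq⟩ := hq
    refine ⟨p₀ + q₀, p₁ + q₁, p₂ + q₂, p₃ + q₃, fun hA hB => ?_⟩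
    rw [map_add, hp hA hB, hq hA hB]
    simp only [map_add]
    ring
  | mul_X p i hp =>
    obtain ⟨p₀, p₁, p₂, p₃, hp⟩ := hp
    fin_cases i
    · refine ⟨p₀ * .X, p₁ * .X, p₂ * .X, p₃ * .X, fun hA hB => ?_⟩
      rw [map_mul, hp hA hB]
      simp
      ring
    · refine ⟨p₁ * f, p₀, p₃ * f, p₂, fun hA hB => ?_⟩
      rw [map_mul, hp hA hB]
      simp [← hA]
      ring
    · refine ⟨p₂ * g, p₃ * g, p₀, p₁, fun hA hB => ?_⟩
      rw [map_mul, hp hA hB]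
      simp [← hB]
      ring

end IsBiquadratic

/-- Equal relation ideals make the generated algebras isomorphic; injectivity then allows the
extension to the fraction field. -/
theorem exists_algHom_adjoin_of_aeval_eq_zero_iff {k F K σ : Type*} [Field k] [Field F] [Field K]
    [Algebra k F] [Algebra k K] (x : σ → F) (y : σ → K)
    (h : ∀ p : MvPolynomial σ k, MvPolynomial.aeval x p = 0 ↔ MvPolynomial.aeval y p = 0) :
    ∃ ι : adjoin k (Set.range x) →ₐ[k] K,
      ∀ i, ι ⟨x i, subset_adjoin k _ ⟨i, rfl⟩⟩ = y i := by
  have hS : (MvPolynomial.aeval x : MvPolynomial σ k →ₐ[k] F).range =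
      Algebra.adjoin k (Set.range x) :=
    (Algebra.adjoin_range_eq_range_aeval k x).symm
  let π : MvPolynomial σ k →ₐ[k] Algebra.adjoin k (Set.range x) :=
    (MvPolynomial.aeval x).codRestrict (Algebra.adjoin k (Set.range x)) fun p => by
    rw [← hS]
    exact ⟨p, rfl⟩
  have hπ : Function.Surjective π := fun ⟨z, hz⟩ => by
    rw [← hS] at hz
    obtain ⟨p, hp⟩ := hz
    exact ⟨p, Subtype.ext hp⟩
  have hker : ∀ p, π p = 0 ↔ MvPolynomial.aeval y p = 0 := fun p => by
    rw [← h p, ← Subtype.coe_inj]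
    rfl
  let φ : Algebra.adjoin k (Set.range x) →ₐ[k] K :=
    AlgHom.liftOfSurjective π hπ (MvPolynomial.aeval y)
    fun p hp => (hker p).1 hp
  have hφ : ∀ p, φ (π p) = MvPolynomial.aeval y p := fun p => by
    exact AlgHom.liftOfSurjective_apply π hπ _ _ p
  have hφi : Function.Injective φ := by
    rw [injective_iff_map_eq_zero]
    intro z hz
    obtain ⟨p, rfl⟩ := hπ z
    rw [hφ] at hz
    exact (hker p).2 hz
  refine ⟨IsFractionRing.liftAlgHom (g := φ) hφi, fun i => ?_⟩
  have h1 := IsFractionRing.lift_algebraMap (K := adjoin k (Set.range x)) (g := φ.toRingHom)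
    hφi (π (MvPolynomial.X i))
  rw [IsFractionRing.coe_liftAlgHom]
  have h2 : algebraMap (Algebra.adjoin k (Set.range x)) (adjoin k (Set.range x))
      (π (MvPolynomial.X i)) = ⟨x i, subset_adjoin k _ ⟨i, rfl⟩⟩ :=
    Subtype.ext (MvPolynomial.aeval_X x i)
  rw [← h2]
  refine h1.trans ?_
  exact (hφ _).trans (MvPolynomial.aeval_X y i)

end Biquadratic

/-! ### Upper bound: regular differentials in Laurent expansions -/

section Expansion

open LaurentSeries IntermediateField

variable {k F : Type u} [Field k] [Field F] [Algebra k F]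

/-- Through `ι` the Euler operator is a derivation of `F` with values in `k((T))`, so the universal
property of `Ω[F⁄k]` applies. -/
theorem exists_expansion_differential (ι : F →ₐ[k] LaurentSeries k) :
    ∃ ℓ : Ω[F⁄k] →ₗ[k] LaurentSeries k,
      ∀ x y, ℓ (x • D k F y) = ι x * eulerDerivation k (ι y) := by
  let _ : Algebra F (LaurentSeries k) := ι.toRingHom.toAlgebra
  have : IsScalarTower k F (LaurentSeries k) := IsScalarTower.of_algebraMap_eq fun c =>
    (ι.commutes c).symm
  let d : Derivation k F (LaurentSeries k) := (eulerDerivation k).compAlgebraMap F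
  refine ⟨d.liftKaehlerDifferential.restrictScalars k, fun x y => ?_⟩
  rw [LinearMap.restrictScalars_apply, map_smul, Derivation.liftKaehlerDifferential_comp_D]
  rfl

/-- Regularity is applied only to the valuation ring `ι⁻¹(k[[T]])`. -/
theorem pos_orderTop_of_mem_regularDifferentials (ι : F →ₐ[k] LaurentSeries k) {x y : F}
    (h : x • D k F y ∈ regularDifferentials k F) :
    0 < (ι x * eulerDerivation k (ι y)).orderTop := by
  obtain ⟨ℓ, hℓ⟩ := exists_expansion_differential ι
  rw [← hℓ]
  let O : ValuationSubring F := (integralSubring k).comap ι.toRingHom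
  have hO : ∀ z, z ∈ O ↔ 0 ≤ (ι z).orderTop := fun z =>
    ValuationSubring.mem_comap.trans mem_integralSubring
  have hk : ∀ c : k, algebraMap k F c ∈ O := fun c => by
    rw [hO, ι.commutes]
    rcases eq_or_ne c 0 with rfl | hc
    · simp
    · exact (HahnSeries.orderTop_single hc).ge
  have hmem := (Submodule.mem_iInf _).1 ((Submodule.mem_iInf _).1 h O) hk
  have hpos : ∀ ω ∈ Submodule.span k {ω | ∃ x ∈ O, ∃ y ∈ O, ω = x • D k F y},
      0 < (ℓ ω).orderTop := by
    intro ω hω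
    induction hω using Submodule.span_induction with
    | mem ω hω =>
      obtain ⟨a, ha, b, hb, rfl⟩ := hω
      rw [hℓ, orderTop_mul']
      exact (orderTop_eulerDerivation ((hO b).1 hb)).trans_le
        (le_add_of_nonneg_left ((hO a).1 ha))
    | zero => simp
    | add a b _ _ ha hb =>
      rw [map_add]
      exact (lt_min ha hb).trans_le HahnSeries.min_orderTop_le_orderTop_add
    | smul c a _ ha =>
      rw [map_smul]
      rw [Algebra.smul_def, orderTop_mul']
      refine ha.trans_le (le_add_of_nonneg_left ?_)
      rw [← mem_integralSubring, ← ι.commutes]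
      exact mem_integralSubring.2 ((hO _).1 (hk c))
  exact hpos _ hmem

/-- Any two biquadratic triples for the same `f, g` satisfy the same polynomial relations. Taking
Laurent series for `w', A', B'` gives the places of `F`; changing the signs of `A', B'` gives the
Galois conjugates. -/
theorem IsBiquadratic.exists_algHom [IsAlgClosed k] [CharZero k] {f g : Polynomial k}
    (hs : (f * g).Separable) (hf : 0 < f.natDegree) (hg : 0 < g.natDegree)
    {w A B : F} (h : IsBiquadratic f g w A B) (htop : adjoin k {w, A, B} = ⊤)
    {K : Type u} [Field K] [Algebra k K] {w' A' B' : K} (h' : IsBiquadratic f g w' A' B') :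
    ∃ ι : F →ₐ[k] K, ι w = w' ∧ ι A = A' ∧ ι B = B' := by
  have : CharZero F := charZero_of_injective_algebraMap (algebraMap k F).injective
  have : CharZero K := charZero_of_injective_algebraMap (algebraMap k K).injective
  have hker : ∀ p : MvPolynomial (Fin 3) k,
      MvPolynomial.aeval ![w, A, B] p = 0 ↔ MvPolynomial.aeval ![w', A', B'] p = 0 := by
    intro p
    obtain ⟨p₀, p₁, p₂, p₃, hp⟩ := exists_reduced_form f g p
    rw [hp h.sq_left h.sq_right, hp h'.sq_left h'.sq_right]
    constructor
    · intro e
      obtain ⟨rfl, rfl, rfl, rfl⟩ := h.polynomial_independent hs hf hg e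
      simp
    · intro e
      obtain ⟨rfl, rfl, rfl, rfl⟩ := h'.polynomial_independent hs hf hg e
      simp
  obtain ⟨ι, hι⟩ := exists_algHom_adjoin_of_aeval_eq_zero_iff _ _ hker
  have hr : ∀ z : F, z ∈ adjoin k (Set.range ![w, A, B]) := by
    have : Set.range ![w, A, B] = {w, A, B} := by
      ext z
      simp only [Matrix.range_cons, Matrix.range_empty, Set.union_empty, Set.singleton_union]
    rw [this, htop]
    exact fun z => mem_top
  refine ⟨ι.comp ((AlgHom.id k F).codRestrict _ hr), hι 0, hι 1, hι 2⟩

end Expansion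

/-! ### Pole and degree bounds from the expansions at finite points and at infinity -/

section UpperBound

open LaurentSeries IntermediateField

variable {k : Type u} [Field k]

theorem transcendental_of_aeval_ne_zero {K : Type*} [Field K] [Algebra k K] {w : K}
    (h : ∀ p : Polynomial k, p ≠ 0 → Polynomial.aeval w p ≠ 0) : Transcendental k w :=
  fun ⟨p, hp, h0⟩ => h p hp h0

theorem order_mul_of_sq {x y : LaurentSeries k} (hx : x ≠ 0) (hy : y ^ 2 = x) :
    y ≠ 0 ∧ 2 * y.order = x.order := by
  have hy0 : y ≠ 0 := by
    rintro rfl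
    exact hx (by rw [← hy]; simp)
  exact ⟨hy0, by rw [← hy, HahnSeries.order_pow]; simp⟩

theorem order_single_two : (HahnSeries.single 2 1 : LaurentSeries k).order = 2 :=
  HahnSeries.order_single one_ne_zero

/-- The local parameter at a point, with a quadratically ramified uniformizer. -/
noncomputable def pointExpansion (c : k) : LaurentSeries k :=
  algebraMap k (LaurentSeries k) c + HahnSeries.single 2 1

/-- The local parameter at infinity, with a quadratically ramified uniformizer. -/
noncomputable def infinityExpansion (k : Type u) [Field k] : LaurentSeries k :=
  (HahnSeries.single 2 1)⁻¹

theorem order_aeval_pointExpansion (c : k) {p : Polynomial k} (hp : p ≠ 0) :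
    Polynomial.aeval (pointExpansion c) p ≠ 0 ∧
      (Polynomial.aeval (pointExpansion c) p).order = 2 * p.rootMultiplicity c := by
  have h := order_aeval_algebraMap_add c (z := HahnSeries.single 2 1)
    (by rw [order_single_two]; norm_num) hp
  rw [order_single_two, mul_comm] at h
  exact h

theorem order_aeval_infinityExpansion {p : Polynomial k} (hp : p ≠ 0) :
    Polynomial.aeval (infinityExpansion k) p ≠ 0 ∧
      (Polynomial.aeval (infinityExpansion k) p).order = -(2 * p.natDegree) := by
  have h := order_aeval_inv (z := (HahnSeries.single 2 1 : LaurentSeries k))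
    (by rw [order_single_two]; norm_num) hp
  rw [order_single_two, mul_comm (p.natDegree : ℤ)] at h
  exact h

theorem infinityExpansion_eq : infinityExpansion k = HahnSeries.single (-2) 1 := by
  rw [infinityExpansion, HahnSeries.inv_single, inv_one]

variable [CharZero k]

theorem eulerDerivation_pointExpansion (c : k) :
    eulerDerivation k (pointExpansion c) ≠ 0 ∧
      (eulerDerivation k (pointExpansion c)).order = 2 := by
  rw [pointExpansion, map_add, Derivation.map_algebraMap, zero_add, eulerDerivation_single]
  norm_num

theorem eulerDerivation_infinityExpansion :
    eulerDerivation k (infinityExpansion k) ≠ 0 ∧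
      (eulerDerivation k (infinityExpansion k)).order = -2 := by
  rw [infinityExpansion_eq, eulerDerivation_single]
  norm_num

variable [IsAlgClosed k]

/-- At `w = c + T²` every nonzero polynomial in `w` has even order, so both roots exist in `k((T))`
whether or not `c` is a branch point. At an unramified point the extra ramification does no harm,
because positivity of the order of `x · T dy/dT` is unaffected by it. -/
theorem isBiquadratic_pointExpansion {f g : Polynomial k} (hf : f ≠ 0) (hg : g ≠ 0) (c : k) :
    ∃ A B, IsBiquadratic f g (pointExpansion c) A B := by
  obtain ⟨hf0, hf1⟩ := order_aeval_pointExpansion c hf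
  obtain ⟨hg0, hg1⟩ := order_aeval_pointExpansion c hg
  obtain ⟨A, hA⟩ := exists_sq_of_even_order hf0 hf1
  obtain ⟨B, hB⟩ := exists_sq_of_even_order hg0 hg1
  exact ⟨A, B, transcendental_of_aeval_ne_zero fun p hp => (order_aeval_pointExpansion c hp).1,
    hA, hB⟩

theorem isBiquadratic_infinityExpansion {f g : Polynomial k} (hf : f ≠ 0) (hg : g ≠ 0) :
    ∃ A B, IsBiquadratic f g (infinityExpansion k) A B := by
  obtain ⟨hf0, hf1⟩ := order_aeval_infinityExpansion hf
  obtain ⟨hg0, hg1⟩ := order_aeval_infinityExpansion hg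
  obtain ⟨A, hA⟩ := exists_sq_of_even_order hf0 (n := -f.natDegree) (by rw [hf1]; ring)
  obtain ⟨B, hB⟩ := exists_sq_of_even_order hg0 (n := -g.natDegree) (by rw [hg1]; ring)
  exact ⟨A, B, transcendental_of_aeval_ne_zero fun p hp => (order_aeval_infinityExpansion hp).1,
    hA, hB⟩

/-- If `(n/d)√h dw` is regular at all finite points, then it has the form `p dw/√h` with a
polynomial `p`. -/
theorem dvd_of_pos_orderTop {n d h : Polynomial k} (hd : d ≠ 0) (hh : h ≠ 0)
    (H : ∀ c : k, ∃ η : LaurentSeries k, η ^ 2 = Polynomial.aeval (pointExpansion c) h ∧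
      0 < (Polynomial.aeval (pointExpansion c) n / Polynomial.aeval (pointExpansion c) d * η *
        eulerDerivation k (pointExpansion c)).orderTop) : d ∣ n * h := by
  rcases eq_or_ne n 0 with rfl | hn
  · simp
  have hnh : n * h ≠ 0 := mul_ne_zero hn hh
  rw [IsAlgClosed.dvd_iff_roots_le_roots hd hnh]
  classical
  rw [Multiset.le_iff_count]
  intro c
  rw [Polynomial.count_roots, Polynomial.count_roots, Polynomial.rootMultiplicity_mul hnh]
  obtain ⟨η, hη, hpos⟩ := H c
  obtain ⟨hn0, hn1⟩ := order_aeval_pointExpansion c hn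
  obtain ⟨hd0, hd1⟩ := order_aeval_pointExpansion c hd
  obtain ⟨hh0, hh1⟩ := order_aeval_pointExpansion c hh
  obtain ⟨he0, he1⟩ := eulerDerivation_pointExpansion c
  obtain ⟨hη0, hη1⟩ := order_mul_of_sq hh0 hη
  have hq := div_ne_zero hn0 hd0
  rw [pos_orderTop_iff (mul_ne_zero (mul_ne_zero hq hη0) he0),
    HahnSeries.order_mul (mul_ne_zero hq hη0) he0, HahnSeries.order_mul hq hη0, he1] at hpos
  have hqo := HahnSeries.order_mul hq hd0
  rw [div_mul_cancel₀ _ hd0, hn1, hd1] at hqo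
  rw [hh1] at hη1
  -- With `ν, δ, μ` the multiplicities of `n, d, h` at `c`, positivity says `2ν - 2δ + μ + 2 > 0`.
  -- Hence `2(δ - ν) ≤ μ + 1`, which gives `δ ≤ ν + μ` in integers, including when `μ = 0`.
  omega

omit [IsAlgClosed k] in
theorem natDegree_lt_of_pos_orderTop {p h : Polynomial k} (hp : p ≠ 0) (hh : h ≠ 0)
    {η : LaurentSeries k} (hη : η ^ 2 = Polynomial.aeval (infinityExpansion k) h)
    (hpos : 0 < (Polynomial.aeval (infinityExpansion k) p /
        Polynomial.aeval (infinityExpansion k) h * η *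
        eulerDerivation k (infinityExpansion k)).orderTop) :
    p.natDegree < (h.natDegree - 1) / 2 := by
  obtain ⟨hn0, hn1⟩ := order_aeval_infinityExpansion hp
  obtain ⟨hh0, hh1⟩ := order_aeval_infinityExpansion hh
  obtain ⟨he0, he1⟩ := eulerDerivation_infinityExpansion (k := k)
  obtain ⟨hη0, hη1⟩ := order_mul_of_sq hh0 hη
  have hq := div_ne_zero hn0 hh0
  rw [pos_orderTop_iff (mul_ne_zero (mul_ne_zero hq hη0) he0),
    HahnSeries.order_mul (mul_ne_zero hq hη0) he0, HahnSeries.order_mul hq hη0, he1] at hpos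
  have hqo := HahnSeries.order_mul hq hh0
  rw [div_mul_cancel₀ _ hh0, hn1, hh1] at hqo
  rw [hh1] at hη1
  -- Positivity at infinity says `-2 deg p + deg h - 2 > 0`, that is `2 deg p ≤ deg h - 3`.
  omega

end UpperBound

/-! ### Lower bound: regularity of `p dw/√h` at every valuation ring -/

section LowerBound

variable {k F : Type*} [Field k] [Field F] [Algebra k F]

theorem ValuationSubring.aeval_mem {O : ValuationSubring F} (hO : ∀ c : k, algebraMap k F c ∈ O)
    {x : F} (hx : x ∈ O) (p : Polynomial k) : Polynomial.aeval x p ∈ O := by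
  rw [Polynomial.aeval_eq_sum_range]
  exact sum_mem fun i _ => by
    rw [Algebra.smul_def]
    exact MulMemClass.mul_mem (hO _) (pow_mem hx _)

theorem ValuationSubring.mem_of_sq_mem {O : ValuationSubring F} {x : F} (hx : x ^ 2 ∈ O) :
    x ∈ O := by
  rcases O.mem_or_inv_mem x with h | h
  · exact h
  · rcases eq_or_ne x 0 with rfl | h0
    · exact zero_mem _
    · have : x = x ^ 2 * x⁻¹ := by field_simp
      rw [this]
      exact MulMemClass.mul_mem hx h

theorem ValuationSubring.valuation_lt_one_of_inv_notMem {O : ValuationSubring F} {x : F}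
    (hx : x⁻¹ ∉ O) : O.valuation x < 1 := by
  rw [← ValuationSubring.valuation_le_one_iff, not_le, map_inv₀] at hx
  have h0 : O.valuation x ≠ 0 := fun h => by simp [h] at hx
  exact (one_lt_inv₀ (zero_lt_iff.2 h0)).1 hx

theorem ValuationSubring.inv_mem_of_valuation_eq_one {O : ValuationSubring F} {x : F}
    (hx : O.valuation x = 1) : x⁻¹ ∈ O := by
  rw [← ValuationSubring.valuation_le_one_iff, map_inv₀, hx, inv_one]

/-- If a polynomial does not vanish at `0`, its value at an element of the maximal ideal is a
unit. -/
theorem ValuationSubring.valuation_aeval_eq_one {O : ValuationSubring F}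
    (hO : ∀ c : k, algebraMap k F c ∈ O) {x : F} (hx : O.valuation x < 1) {p : Polynomial k}
    (hp : p.coeff 0 ≠ 0) : O.valuation (Polynomial.aeval x p) = 1 := by
  have h1 : Polynomial.aeval x p = Polynomial.aeval x p.divX * x + algebraMap k F (p.coeff 0) := by
    conv_lhs => rw [← p.divX_mul_X_add]
    simp
  have hc : O.valuation (algebraMap k F (p.coeff 0)) = 1 := by
    refine le_antisymm ((O.valuation_le_one_iff _).2 (hO _)) ?_
    have h2 := (O.valuation_le_one_iff _).2 (hO (p.coeff 0)⁻¹)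
    rw [map_inv₀, map_inv₀] at h2
    exact (inv_le_one₀ (zero_lt_iff.2 (by simpa using hp))).1 h2
  rw [h1, Valuation.map_add_eq_of_lt_right]
  · exact hc
  rw [hc, map_mul]
  exact mul_lt_one_of_nonneg_of_lt_one_right
    ((O.valuation_le_one_iff _).2 (ValuationSubring.aeval_mem hO
      ((O.valuation_le_one_iff _).1 hx.le) _)) zero_le hx

theorem two_mul_smul_D_of_sq {h : Polynomial k} {x y : F} (hy : y ^ 2 = Polynomial.aeval x h) :
    (2 * y) • D k F y = Polynomial.aeval x (Polynomial.derivative h) • D k F x := by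
  rw [← Derivation.map_aeval, ← hy, Derivation.leibniz_pow, mul_smul]
  simp [two_smul, ← Nat.cast_smul_eq_nsmul F]

/-- Either `dx/y` is already integral because `y` is a unit, or `y² = h(x)` gives `dx/y = 2
dy/h'(x)` with a unit denominator. -/
theorem div_smul_D_mem_span {O : ValuationSubring F} (hO : ∀ c : k, algebraMap k F c ∈ O)
    {h : Polynomial k} {x y u : F} (hx : x ∈ O) (hu : u ∈ O)
    (hy : y ^ 2 = Polynomial.aeval x h)
    (H : y⁻¹ ∈ O ∨ O.valuation (Polynomial.aeval x (Polynomial.derivative h)) = 1) :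
    (u / y) • D k F x ∈ Submodule.span k {ω | ∃ x ∈ O, ∃ y ∈ O, ω = x • D k F y} := by
  apply Submodule.subset_span
  rcases H with H | H
  · exact ⟨u / y, div_eq_mul_inv u y ▸ mul_mem hu H, x, hx, rfl⟩
  · have hyO : y ∈ O := ValuationSubring.mem_of_sq_mem (hy ▸ ValuationSubring.aeval_mem hO hx h)
    rcases eq_or_ne y 0 with rfl | hy0
    · exact ⟨0, zero_mem _, x, hx, by simp⟩
    have hd : Polynomial.aeval x (Polynomial.derivative h) ≠ 0 := fun hd => by simp [hd] at H
    refine ⟨2 * u * (Polynomial.aeval x (Polynomial.derivative h))⁻¹, mul_mem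
        (mul_mem (ofNat_mem O 2) hu)
        (ValuationSubring.inv_mem_of_valuation_eq_one H), y, hyO, ?_⟩
    have h2 : 2 * u * (Polynomial.aeval x (Polynomial.derivative h))⁻¹ =
        (u / y * (Polynomial.aeval x (Polynomial.derivative h))⁻¹) * (2 * y) := by
        field_simp
    rw [h2, mul_smul, two_mul_smul_D_of_sq hy, ← mul_smul, inv_mul_cancel_right₀ hd]

/-- The affine model `y² = h(w)` is smooth, and so is the model in `1/w` near `1/w = 0`; every
valuation ring over `k` is centered on one of the two. Discreteness of the valuation plays no role.
-/
theorem div_smul_D_mem_regularDifferentials {h p : Polynomial k} (hs : h.Separable) {w y : F}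
    (hy : y ^ 2 = Polynomial.aeval w h) (hp : p.natDegree < (h.natDegree - 1) / 2) :
    (Polynomial.aeval w p / y) • D k F w ∈ regularDifferentials k F := by
  have h0 : h ≠ 0 := by
    rintro rfl
    simp at hp
  refine (Submodule.mem_iInf _).2 fun O => (Submodule.mem_iInf _).2 fun hO => ?_
  by_cases hw : w ∈ O
  · refine div_smul_D_mem_span hO hw (ValuationSubring.aeval_mem hO hw p) hy ?_
    -- If `y` and `h'(w)` were both nonunits, the Bézout identity `1 = a y² + b h'(w)` would give
    -- `1` a valuation below `1`.
    by_contra! H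
    obtain ⟨a, b, hab⟩ := hs
    have h1 := congrArg (fun q => O.valuation (Polynomial.aeval w q)) hab
    simp only [map_add, map_mul, ← hy, map_one] at h1
    refine absurd h1 (ne_of_lt ?_)
    have hle : ∀ q : Polynomial k, O.valuation (Polynomial.aeval w q) ≤ 1 := fun q =>
      (O.valuation_le_one_iff _).2 (ValuationSubring.aeval_mem hO hw q)
    have hy1 := ValuationSubring.valuation_lt_one_of_inv_notMem H.1
    have hd1 := lt_of_le_of_ne (hle _) H.2
    refine Valuation.map_add_lt _ ?_ ?_
    · rw [map_mul, map_pow]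
      exact mul_lt_one_of_nonneg_of_lt_one_right (hle a) zero_le
        (pow_lt_one₀ zero_le hy1 two_ne_zero)
    · rw [map_mul]
      exact mul_lt_one_of_nonneg_of_lt_one_right (hle b) zero_le hd1
  · have hw0 : w ≠ 0 := by
      rintro rfl
      exact hw (zero_mem _)
    set x := w⁻¹ with hx
    have hx0 : x ≠ 0 := inv_ne_zero hw0
    have hxw : w = x⁻¹ := (inv_inv w).symm
    have hx1 : O.valuation x < 1 :=
      ValuationSubring.valuation_lt_one_of_inv_notMem (by rwa [← hxw])
    have hxO : x ∈ O := (O.valuation_le_one_iff _).1 hx1.le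
    have hrev : ∀ q : Polynomial k,
        Polynomial.aeval w q = Polynomial.aeval x q.reverse / x ^ q.natDegree := by
      intro q
      let : Invertible w := ⟨x, inv_mul_cancel₀ hw0, mul_inv_cancel₀ hw0⟩
      have h := Polynomial.eval₂_reverse_mul_pow (algebraMap k F) w q
      change Polynomial.aeval x q.reverse * _ = Polynomial.aeval w q at h
      rw [← h, hxw, inv_pow, div_eq_mul_inv]
    -- `e = ⌈deg h / 2⌉`, so `y x^e` is the square root in the chart at infinity; the extra factor
    -- `X` in `h₁` occurs exactly for odd `deg h`, when infinity is a branch point.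
    set e := (h.natDegree + 1) / 2 with he
    set h₁ := Polynomial.X ^ (2 * e - h.natDegree) * h.reverse with hh₁
    have hy₁ : (y * x ^ e) ^ 2 = Polynomial.aeval x h₁ := by
      rw [mul_pow, hy, hrev, hh₁, map_mul, map_pow, Polynomial.aeval_X, ← pow_mul]
      have : x ^ (e * 2) = x ^ (2 * e - h.natDegree) * x ^ h.natDegree := by
        rw [← pow_add]
        congr 1
        omega
      rw [this]
      field_simp
    have hDw : D k F w = (-(x ^ 2)⁻¹) • D k F x := by
      rw [hxw, Derivation.leibniz_inv]
      congr 1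
      ring
    have hcoef : (Polynomial.aeval w p / y) • D k F w =
        ((-(x ^ (e - (p.natDegree + 2)) * Polynomial.aeval x p.reverse)) / (y * x ^ e)) •
          D k F x := by
      rw [hDw, ← mul_smul, hrev p]
      congr 1
      rcases eq_or_ne y 0 with rfl | hy0
      · simp
      -- The degree bound is exactly `deg p + 2 ≤ e`: the factor `x^e` absorbs the pole of `p(w)`
      -- and the double pole of `dw = -x⁻² dx`.
      have : x ^ e = x ^ (e - (p.natDegree + 2)) * (x ^ p.natDegree * x ^ 2) := by
        rw [← pow_add, ← pow_add]
        congr 1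
        omega
      rw [this]
      field_simp
    rw [hcoef]
    refine div_smul_D_mem_span hO hxO (neg_mem (mul_mem (pow_mem hxO _)
      (ValuationSubring.aeval_mem hO hxO _))) hy₁ ?_
    have hc : h.reverse.coeff 0 ≠ 0 := by simpa using h0
    -- For even degree `h₁(0) ≠ 0` and `y x^e` is a unit; for odd degree `h₁` has a simple zero at
    -- `0`, so `h₁'(x)` is a unit.
    rcases Nat.even_or_odd' h.natDegree with ⟨m, hm | hm⟩
    · left
      have h2 : 2 * e - h.natDegree = 0 := by omega
      apply ValuationSubring.mem_of_sq_mem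
      rw [inv_pow, hy₁, hh₁, h2, pow_zero, one_mul]
      exact ValuationSubring.inv_mem_of_valuation_eq_one
        (ValuationSubring.valuation_aeval_eq_one hO hx1 hc)
    · right
      have h2 : 2 * e - h.natDegree = 1 := by omega
      apply ValuationSubring.valuation_aeval_eq_one hO hx1
      rw [hh₁, h2, pow_one, Polynomial.derivative_mul, Polynomial.derivative_X, one_mul,
        Polynomial.coeff_add, Polynomial.mul_coeff_zero, Polynomial.coeff_X_zero, zero_mul,
        add_zero]
      exact hc

end LowerBound

/-! ### The regular differentials of a biquadratic function field -/

section Rank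

open LaurentSeries IntermediateField

theorem exists_eq_smul_D {k F : Type*} [Field k] [Field F] [Algebra k F] [CharZero F]
    {f g : Polynomial k} {w A B : F} (hA : A ^ 2 = Polynomial.aeval w f)
    (hB : B ^ 2 = Polynomial.aeval w g) (htop : adjoin k {w, A, B} = ⊤) (ω : Ω[F⁄k]) :
    ∃ x : F, ω = x • D k F w := by
  have hsqrt : ∀ {p : Polynomial k} {y : F}, y ^ 2 = Polynomial.aeval w p →
      ∃ x : F, D k F y = x • D k F w := by
    intro p y hy
    rcases eq_or_ne y 0 with rfl | hy0
    · exact ⟨0, by simp⟩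
    · refine ⟨(2 * y)⁻¹ * Polynomial.aeval w (Polynomial.derivative p), ?_⟩
      rw [mul_smul, ← two_mul_smul_D_of_sq hy, inv_smul_smul₀ (mul_ne_zero two_ne_zero hy0)]
  have hD : ∀ y : F, ∃ x : F, D k F y = x • D k F w := by
    intro y
    have hy : y ∈ adjoin k {w, A, B} := htop ▸ mem_top
    induction hy using IntermediateField.adjoin_induction with
    | mem y hy =>
      rcases hy with rfl | rfl | rfl
      · exact ⟨1, (one_smul _ _).symm⟩
      · exact hsqrt hA
      · exact hsqrt hB
    | algebraMap y => exact ⟨0, by simp⟩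
    | add y z _ _ hy hz =>
      obtain ⟨a, ha⟩ := hy
      obtain ⟨b, hb⟩ := hz
      exact ⟨a + b, by rw [map_add, ha, hb, add_smul]⟩
    | mul y z _ _ hy hz =>
      obtain ⟨a, ha⟩ := hy
      obtain ⟨b, hb⟩ := hz
      exact ⟨y * b + z * a, by
        rw [Derivation.leibniz, ha, hb, add_smul, mul_smul, mul_smul]⟩
    | inv y _ hy =>
      obtain ⟨a, ha⟩ := hy
      exact ⟨-y⁻¹ ^ 2 * a, by rw [Derivation.leibniz_inv, ha, mul_smul]⟩
  have hω : ω ∈ Submodule.span F (Set.range (D k F)) := by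
    rw [KaehlerDifferential.span_range_derivation]
    exact Submodule.mem_top
  induction hω using Submodule.span_induction with
  | mem ω hω =>
    obtain ⟨y, rfl⟩ := hω
    exact hD y
  | zero => exact ⟨0, by simp⟩
  | add a b _ _ ha hb =>
    obtain ⟨x, rfl⟩ := ha
    obtain ⟨y, rfl⟩ := hb
    exact ⟨x + y, (add_smul _ _ _).symm⟩
  | smul c a _ ha =>
    obtain ⟨x, rfl⟩ := ha
    exact ⟨c * x, (mul_smul _ _ _).symm⟩

variable {k F : Type u} [Field k] [IsAlgClosed k] [CharZero k] [Field F] [Algebra k F]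
  {f g : Polynomial k} {w A B : F}

/-- The four sign choices for `A', B'` give four embeddings. Their signed sums are `4` times the
single components, so poles of different components cannot cancel. -/
theorem pos_orderTop_components (hs : (f * g).Separable) (hf : 0 < f.natDegree)
    (hg : 0 < g.natDegree) (h : IsBiquadratic f g w A B) (htop : adjoin k {w, A, B} = ⊤)
    {w' A' B' : LaurentSeries k} (h' : IsBiquadratic f g w' A' B')
    {n₀ d₀ n₁ d₁ n₂ d₂ n₃ d₃ : Polynomial k}
    (hreg : (Polynomial.aeval w n₀ / Polynomial.aeval w d₀ +
      Polynomial.aeval w n₁ / Polynomial.aeval w d₁ * A +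
      Polynomial.aeval w n₂ / Polynomial.aeval w d₂ * B +
      Polynomial.aeval w n₃ / Polynomial.aeval w d₃ * (A * B)) • D k F w ∈
        regularDifferentials k F) :
    0 < (Polynomial.aeval w' n₀ / Polynomial.aeval w' d₀ * 1 *
        eulerDerivation k w').orderTop ∧
    0 < (Polynomial.aeval w' n₁ / Polynomial.aeval w' d₁ * A' *
        eulerDerivation k w').orderTop ∧
    0 < (Polynomial.aeval w' n₂ / Polynomial.aeval w' d₂ * B' *
        eulerDerivation k w').orderTop ∧
    0 < (Polynomial.aeval w' n₃ / Polynomial.aeval w' d₃ * (A' * B') *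
        eulerDerivation k w').orderTop := by
  set E₀ := Polynomial.aeval w' n₀ / Polynomial.aeval w' d₀
  set E₁ := Polynomial.aeval w' n₁ / Polynomial.aeval w' d₁
  set E₂ := Polynomial.aeval w' n₂ / Polynomial.aeval w' d₂
  set E₃ := Polynomial.aeval w' n₃ / Polynomial.aeval w' d₃
  have key : ∀ {a b : LaurentSeries k}, IsBiquadratic f g w' a b →
      0 < ((E₀ + E₁ * a + E₂ * b + E₃ * (a * b)) * eulerDerivation k w').orderTop := by
    intro a b hab
    obtain ⟨ι, rfl, rfl, rfl⟩ := h.exists_algHom hs hf hg htop hab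
    have := pos_orderTop_of_mem_regularDifferentials ι hreg
    simpa only [map_add, map_mul, map_div₀, ← Polynomial.aeval_algHom_apply] using this
  have h1 := key h'
  have h2 := key (a := -A') (b := B')
    ⟨h'.transcendental, by rw [neg_sq, h'.sq_left], h'.sq_right⟩
  have h3 := key (a := A') (b := -B')
    ⟨h'.transcendental, h'.sq_left, by rw [neg_sq, h'.sq_right]⟩
  have h4 := key (a := -A') (b := -B')
    ⟨h'.transcendental, by rw [neg_sq, h'.sq_left], by rw [neg_sq, h'.sq_right]⟩
  have hadd : ∀ {x y : LaurentSeries k}, 0 < x.orderTop → 0 < y.orderTop →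
      0 < (x + y).orderTop := fun hx hy =>
    (lt_min hx hy).trans_le HahnSeries.min_orderTop_le_orderTop_add
  have hneg : ∀ {x : LaurentSeries k}, 0 < x.orderTop → 0 < (-x).orderTop := fun hx => by
    rwa [HahnSeries.orderTop_neg]
  have hsmul : ∀ {x : LaurentSeries k}, 0 < (4 * x).orderTop → 0 < x.orderTop := by
    intro x hx
    have h4 : (4 : LaurentSeries k) = algebraMap k _ 4 := (map_ofNat _ 4).symm
    have h5 : (algebraMap k (LaurentSeries k) 4).orderTop = 0 :=
      HahnSeries.orderTop_single (by norm_num)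
    rwa [orderTop_mul', h4, h5, zero_add] at hx
  refine ⟨hsmul ?_, hsmul ?_, hsmul ?_, hsmul ?_⟩
  · convert hadd (hadd h1 h2) (hadd h3 h4) using 2
    ring
  · convert hadd (hadd h1 (hneg h2)) (hadd h3 (hneg h4)) using 2
    ring
  · convert hadd (hadd h1 h2) (hadd (hneg h3) (hneg h4)) using 2
    ring
  · convert hadd (hadd h1 (hneg h2)) (hadd (hneg h3) h4) using 2
    ring

/-- A component of a regular differential: if `(n/d)H dw` with `H² = h(w)` is regular, then it
has the form `p dw/H` with a polynomial `p` of bounded degree. -/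
theorem exists_polynomial_of_pos_orderTop (hw : Transcendental k w) {n d h : Polynomial k}
    (hd : Polynomial.aeval w d ≠ 0) (hh : h ≠ 0) {H : F} (hH : H ^ 2 = Polynomial.aeval w h)
    (hfin : ∀ c : k, ∃ η : LaurentSeries k, η ^ 2 = Polynomial.aeval (pointExpansion c) h ∧
      0 < (Polynomial.aeval (pointExpansion c) n / Polynomial.aeval (pointExpansion c) d * η *
        eulerDerivation k (pointExpansion c)).orderTop)
    (hinf : ∃ η : LaurentSeries k, η ^ 2 = Polynomial.aeval (infinityExpansion k) h ∧
      0 < (Polynomial.aeval (infinityExpansion k) n / Polynomial.aeval (infinityExpansion k) d *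
        η * eulerDerivation k (infinityExpansion k)).orderTop) :
    ∃ p ∈ Polynomial.degreeLT k ((h.natDegree - 1) / 2),
      Polynomial.aeval w n / Polynomial.aeval w d * H = Polynomial.aeval w p / H := by
  have hd0 : d ≠ 0 := by
    rintro rfl
    simp at hd
  obtain ⟨p, hp⟩ := dvd_of_pos_orderTop hd0 hh hfin
  have hhw : Polynomial.aeval w h ≠ 0 := fun h0 => hw ⟨h, hh, h0⟩
  have hH0 : H ≠ 0 := by
    rintro rfl
    exact hhw (by rw [← hH]; simp)
  refine ⟨p, ?_, ?_⟩
  · rcases eq_or_ne p 0 with rfl | hp0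
    · exact zero_mem _
    rw [Polynomial.mem_degreeLT, ← Polynomial.natDegree_lt_iff_degree_lt hp0]
    obtain ⟨η, hη, hpos⟩ := hinf
    refine natDegree_lt_of_pos_orderTop hp0 hh hη ?_
    have h1 := (order_aeval_infinityExpansion (k := k) hd0).1
    have h2 := (order_aeval_infinityExpansion (k := k) hh).1
    have h3 : Polynomial.aeval (infinityExpansion k) n / Polynomial.aeval (infinityExpansion k) d =
      Polynomial.aeval (infinityExpansion k) p / Polynomial.aeval (infinityExpansion k) h := by
      rw [div_eq_div_iff h1 h2, ← map_mul, hp, map_mul, mul_comm]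
    rwa [← h3]
  · rw [eq_div_iff hH0, mul_assoc, ← sq, hH, div_mul_eq_mul_div, ← map_mul, hp, map_mul,
      mul_div_cancel_left₀ _ hd]

/-- Expanding at `w = T²` sends `dw` to `2T²`, which is nonzero. -/
theorem D_ne_zero (hs : (f * g).Separable) (hf : 0 < f.natDegree)
    (hg : 0 < g.natDegree) (h : IsBiquadratic f g w A B) (htop : adjoin k {w, A, B} = ⊤) :
    D k F w ≠ 0 := by
  intro h0
  have hf0 : f ≠ 0 := by rintro rfl; simp at hf
  have hg0 : g ≠ 0 := by rintro rfl; simp at hg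
  obtain ⟨A', B', h'⟩ := isBiquadratic_pointExpansion hf0 hg0 (0 : k)
  obtain ⟨ι, hι, -⟩ := h.exists_algHom hs hf hg htop h'
  obtain ⟨ℓ, hℓ⟩ := exists_expansion_differential ι
  have h1 := hℓ 1 w
  rw [h0, smul_zero, map_zero, map_one, one_mul, hι] at h1
  exact (eulerDerivation_pointExpansion (0 : k)).1 h1.symm

/-- The differentials `(p₁/A + p₂/B + p₃/(AB)) dw`. -/
noncomputable def biquadraticDifferential (k : Type u) {F : Type u} [Field k] [Field F]
    [Algebra k F] (w A B : F) :
    Polynomial k × Polynomial k × Polynomial k →ₗ[k] Ω[F⁄k] where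
  toFun p := (Polynomial.aeval w p.1 / A + Polynomial.aeval w p.2.1 / B +
    Polynomial.aeval w p.2.2 / (A * B)) • D k F w
  map_add' p q := by
    rw [← add_smul]
    congr 1
    simp only [Prod.fst_add, Prod.snd_add, map_add, add_div]
    ring
  map_smul' c p := by
    rw [RingHom.id_apply, ← smul_assoc]
    congr 1
    simp only [Prod.smul_fst, Prod.smul_snd, map_smul, smul_add, smul_div_assoc]

theorem biquadraticDifferential_injective (hs : (f * g).Separable) (hf : 0 < f.natDegree)
    (hg : 0 < g.natDegree) (h : IsBiquadratic f g w A B) (htop : adjoin k {w, A, B} = ⊤) :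
    Function.Injective (biquadraticDifferential k w A B) := by
  have : CharZero F := charZero_of_injective_algebraMap (algebraMap k F).injective
  have hf0 : f ≠ 0 := by rintro rfl; simp at hf
  have hg0 : g ≠ 0 := by rintro rfl; simp at hg
  have hfw : Polynomial.aeval w f ≠ 0 := fun h0 => h.transcendental ⟨f, hf0, h0⟩
  have hgw : Polynomial.aeval w g ≠ 0 := fun h0 => h.transcendental ⟨g, hg0, h0⟩
  have hA0 : A ≠ 0 := by
    rintro rfl
    exact hfw (by rw [← h.sq_left]; simp)
  have hB0 : B ≠ 0 := by
    rintro rfl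
    exact hgw (by rw [← h.sq_right]; simp)
  rw [injective_iff_map_eq_zero]
  rintro ⟨p₁, p₂, p₃⟩ hp
  have h1 := (smul_eq_zero.1 hp).resolve_right (D_ne_zero hs hf hg h htop)
  dsimp only at h1
  -- Multiplying `p₁/A + p₂/B + p₃/(AB)` by `A²B²` turns it into `p₁ g A + p₂ f B + p₃ AB`.
  obtain ⟨-, h3, h2, h1⟩ := h.polynomial_independent hs hf hg (p₀ := 0)
    (p₁ := p₁ * g) (p₂ := p₂ * f) (p₃ := p₃) (by
      simp only [map_mul, ← h.sq_left, ← h.sq_right, map_zero]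
      field_simp at h1
      linear_combination (A * B) * h1)
  rw [h1, (mul_eq_zero.1 h2).resolve_right hf0, (mul_eq_zero.1 h3).resolve_right hg0]
  rfl

/-- One inclusion is regularity at every valuation ring; the other splits a regular form into its
four components and bounds each by its expansions. -/
theorem map_biquadraticDifferential (hs : (f * g).Separable) (hf : 0 < f.natDegree)
    (hg : 0 < g.natDegree) (h : IsBiquadratic f g w A B) (htop : adjoin k {w, A, B} = ⊤) :
    ((Polynomial.degreeLT k ((f.natDegree - 1) / 2)).prod
      ((Polynomial.degreeLT k ((g.natDegree - 1) / 2)).prod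
        (Polynomial.degreeLT k (((f * g).natDegree - 1) / 2)))).map
      (biquadraticDifferential k w A B) = regularDifferentials k F := by
  have : CharZero F := charZero_of_injective_algebraMap (algebraMap k F).injective
  have hf0 : f ≠ 0 := by rintro rfl; simp at hf
  have hg0 : g ≠ 0 := by rintro rfl; simp at hg
  apply le_antisymm
  · rintro _ ⟨⟨p₁, p₂, p₃⟩, ⟨h1, h2, h3⟩, rfl⟩
    have hmem : ∀ {q p : Polynomial k} {y : F}, q.Separable → y ^ 2 = Polynomial.aeval w q →
        p ∈ Polynomial.degreeLT k ((q.natDegree - 1) / 2) →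
        (Polynomial.aeval w p / y) • D k F w ∈ regularDifferentials k F := by
      intro q p y hq hy hp
      rcases eq_or_ne p 0 with rfl | hp0
      · simp
      rw [Polynomial.mem_degreeLT, ← Polynomial.natDegree_lt_iff_degree_lt hp0] at hp
      exact div_smul_D_mem_regularDifferentials hq hy hp
    have := add_mem (add_mem (hmem hs.of_mul_left h.sq_left h1)
      (hmem hs.of_mul_right h.sq_right h2)) (hmem hs h.mul_sq h3)
    rwa [← add_smul, ← add_smul] at this
  · intro ω hω
    obtain ⟨x, rfl⟩ := exists_eq_smul_D h.sq_left h.sq_right htop ω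
    obtain ⟨e₀, h₀, e₁, h₁, e₂, h₂, e₃, h₃, rfl⟩ :=
      h.comb_of_mem_adjoin hs hf hg (x := x) (htop ▸ mem_top)
    have hfrac : ∀ {e : F}, e ∈ k⟮w⟯ → ∃ n d : Polynomial k, Polynomial.aeval w d ≠ 0 ∧
        e = Polynomial.aeval w n / Polynomial.aeval w d := by
      intro e he
      obtain ⟨n, d, rfl⟩ := (mem_adjoin_simple_iff k e).1 he
      by_cases hd : Polynomial.aeval w d = 0
      · exact ⟨0, 1, by simp, by simp [hd]⟩
      · exact ⟨n, d, hd, rfl⟩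
    obtain ⟨n₀, d₀, hd₀, rfl⟩ := hfrac h₀
    obtain ⟨n₁, d₁, hd₁, rfl⟩ := hfrac h₁
    obtain ⟨n₂, d₂, hd₂, rfl⟩ := hfrac h₂
    obtain ⟨n₃, d₃, hd₃, rfl⟩ := hfrac h₃
    have hfin : ∀ c : k, ∃ A' B', IsBiquadratic f g (pointExpansion c) A' B' :=
      fun c => isBiquadratic_pointExpansion hf0 hg0 c
    obtain ⟨A', B', hinf⟩ := isBiquadratic_infinityExpansion hf0 hg0
    have Hinf := pos_orderTop_components hs hf hg h htop hinf hω
    choose a b hab using hfin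
    have Hfin := fun c => pos_orderTop_components hs hf hg h htop (hab c) hω
    obtain ⟨p₀, hp₀, q₀⟩ := exists_polynomial_of_pos_orderTop h.transcendental hd₀ one_ne_zero
      (H := 1) (by simp) (fun c => ⟨1, by simp, (Hfin c).1⟩) ⟨1, by simp, Hinf.1⟩
    obtain ⟨p₁, hp₁, q₁⟩ := exists_polynomial_of_pos_orderTop h.transcendental hd₁ hf0
      h.sq_left (fun c => ⟨a c, (hab c).sq_left, (Hfin c).2.1⟩) ⟨A', hinf.sq_left, Hinf.2.1⟩
    obtain ⟨p₂, hp₂, q₂⟩ := exists_polynomial_of_pos_orderTop h.transcendental hd₂ hg0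
      h.sq_right (fun c => ⟨b c, (hab c).sq_right, (Hfin c).2.2.1⟩)
      ⟨B', hinf.sq_right, Hinf.2.2.1⟩
    obtain ⟨p₃, hp₃, q₃⟩ := exists_polynomial_of_pos_orderTop h.transcendental hd₃
      (mul_ne_zero hf0 hg0) h.mul_sq
      (fun c => ⟨a c * b c, (hab c).mul_sq, (Hfin c).2.2.2⟩)
      ⟨A' * B', hinf.mul_sq, Hinf.2.2.2⟩
    -- The invariant component has `h = 1`, and the truncated `(0 - 1) / 2` is `0`: there are no
    -- regular differentials on the `w`-line.
    have hp₀' : p₀ = 0 := by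
      simpa [Polynomial.mem_degreeLT, Polynomial.degree_eq_bot] using hp₀
    rw [mul_one, hp₀', map_zero, zero_div] at q₀
    refine ⟨⟨p₁, p₂, p₃⟩, ⟨hp₁, hp₂, hp₃⟩, ?_⟩
    rw [q₀, q₁, q₂, q₃, zero_add]
    rfl

/-- The genus of the function field `k(w, √f(w), √g(w))`. -/
theorem rank_regularDifferentials_of_isBiquadratic (hs : (f * g).Separable)
    (hf : 0 < f.natDegree) (hg : 0 < g.natDegree) (h : IsBiquadratic f g w A B)
    (htop : adjoin k {w, A, B} = ⊤) :
    Module.rank k (regularDifferentials k F) =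
      (((f.natDegree - 1) / 2 + ((g.natDegree - 1) / 2 + ((f * g).natDegree - 1) / 2) : ℕ) :
        Cardinal) := by
  have hrank : ∀ n, Module.rank k (Polynomial.degreeLT k n) = n := fun n => by
    rw [(Polynomial.degreeLTEquiv k n).rank_eq, rank_fin_fun]
  rw [← map_biquadraticDifferential hs hf hg h htop]
  set P := Polynomial.degreeLT k ((f.natDegree - 1) / 2)
  set Q := Polynomial.degreeLT k ((g.natDegree - 1) / 2)
  set R := Polynomial.degreeLT k (((f * g).natDegree - 1) / 2)
  have hrange : (P.prod (Q.prod R)).map (biquadraticDifferential k w A B) =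
      LinearMap.range ((biquadraticDifferential k w A B).comp
        (P.subtype.prodMap (Q.subtype.prodMap R.subtype))) := by
    rw [LinearMap.range_comp, LinearMap.range_prodMap, LinearMap.range_prodMap,
      Submodule.range_subtype, Submodule.range_subtype, Submodule.range_subtype]
  rw [hrange, ← (LinearEquiv.ofInjective _ ?_).rank_eq]
  · simp [P, Q, R, hrank]
  · exact (biquadraticDifferential_injective hs hf hg h htop).comp
      (Function.Injective.prodMap P.injective_subtype
        (Function.Injective.prodMap Q.injective_subtype R.injective_subtype))

open scoped IntermediateField.algebraAdjoinAdjoin in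
theorem trdeg_eq_one_of_isBiquadratic (hs : (f * g).Separable)
    (hf : 0 < f.natDegree) (hg : 0 < g.natDegree) (h : IsBiquadratic f g w A B)
    (htop : adjoin k {w, A, B} = ⊤) : Algebra.trdeg k F = 1 := by
  have : CharZero F := charZero_of_injective_algebraMap (algebraMap k F).injective
  have hsqrt : ∀ {y : F}, y ^ 2 ∈ k⟮w⟯ → IsIntegral k⟮w⟯ y := fun {y} hy =>
    IsIntegral.of_pow two_pos (isIntegral_algebraMap (x := (⟨y ^ 2, hy⟩ : k⟮w⟯)))
  have hA := hsqrt h.sq_left_mem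
  have hB := hsqrt h.sq_right_mem
  have halg : Algebra.IsAlgebraic k⟮w⟯ F := ⟨fun x => by
    obtain ⟨e₀, h₀, e₁, h₁, e₂, h₂, e₃, h₃, rfl⟩ :=
      h.comb_of_mem_adjoin hs hf hg (x := x) (htop ▸ mem_top)
    have hE : ∀ {e : F}, e ∈ k⟮w⟯ → IsIntegral k⟮w⟯ e := fun {e} he =>
      isIntegral_algebraMap (x := (⟨e, he⟩ : k⟮w⟯))
    exact ((((hE h₀).add ((hE h₁).mul hA)).add ((hE h₂).mul hB)).add
      ((hE h₃).mul (hA.mul hB))).isAlgebraic⟩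
  have hb : IsTranscendenceBasis k (fun _ : Unit => w) := by
    rw [isTranscendenceBasis_iff_algebraicIndependent_isAlgebraic]
    refine ⟨algebraicIndependent_unique_type_iff.2 h.transcendental, ?_⟩
    rw [Set.range_const]
    exact Algebra.IsAlgebraic.trans _ k⟮w⟯ _
  have := hb.lift_cardinalMk_eq_trdeg
  simpa using this.symm

end Rank

/-! ### The homogeneous ideal of the 224 curve -/

section HomogeneousIdeal

/-- The equations of the 224 curve. -/
structure Is224Point {k R : Type*} [Field k] [CommRing R] [Algebra k R] (a : k)
    (q r s t z : R) : Prop where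
  sq_s : s ^ 2 = t ^ 2 + t * z - algebraMap k R a * z ^ 2
  sq_q : q ^ 2 = t ^ 2 - algebraMap k R a * z ^ 2 + s * z
  sq_r : r ^ 2 = t ^ 2 - algebraMap k R a * z ^ 2 - s * z

/-- The combination of `1, q, r, qr` with coefficients `αᵢ + βᵢ s`. -/
def octicComb {R : Type*} [CommRing R] (q r s : R) (α β : Fin 4 → R) : R :=
  (α 0 + β 0 * s) + (α 1 + β 1 * s) * q + (α 2 + β 2 * s) * r + (α 3 + β 3 * s) * (q * r)

/-- The equations rewrite `s², q², r²`, so division leaves eight monomials over `k[t, z]`. The form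
is chosen before the ring and the point, so it can be compared between the generic point and all
others. -/
theorem exists_octic_form {k : Type u} [Field k] (a : k) (G : MvPolynomial (Fin (4 + 1)) k) :
    ∃ α β : Fin 4 → MvPolynomial (Fin 2) k, ∀ {R : Type u} [CommRing R] [Algebra k R]
      {q r s t z : R}, Is224Point a q r s t z → aeval ![q, r, s, t, z] G =
        octicComb q r s (fun i => aeval ![t, z] (α i)) (fun i => aeval ![t, z] (β i)) := by
  let T : MvPolynomial (Fin 2) k := X 0
  let Z : MvPolynomial (Fin 2) k := X 1
  let U : MvPolynomial (Fin 2) k := T ^ 2 - C a * Z ^ 2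
  let S : MvPolynomial (Fin 2) k := T ^ 2 + T * Z - C a * Z ^ 2
  induction G using MvPolynomial.induction_on with
  | C c => exact ⟨![C c, 0, 0, 0], 0, fun _ => by simp [octicComb]⟩
  | add G H hG hH =>
    obtain ⟨α, β, hG⟩ := hG
    obtain ⟨γ, δ, hH⟩ := hH
    refine ⟨α + γ, β + δ, fun h => ?_⟩
    rw [map_add, hG h, hH h]
    simp only [octicComb, Pi.add_apply, map_add]
    ring
  | mul_X G i hG =>
    obtain ⟨α, β, hG⟩ := hG
    fin_cases i
    · refine ⟨![α 1 * U + β 1 * Z * S, α 0, α 3 * U + β 3 * Z * S, α 2],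
        ![α 1 * Z + β 1 * U, β 0, α 3 * Z + β 3 * U, β 2], fun {R} _ _ {q r s t z} h => ?_⟩
      rw [map_mul, hG h]
      generalize hα : (fun i => (aeval ![t, z]) (α i)) = α' at *
      generalize hβ : (fun i => (aeval ![t, z]) (β i)) = β' at *
      have hα' := fun i => congrFun hα i
      have hβ' := fun i => congrFun hβ i
      simp [octicComb, U, S, T, Z, hα', hβ', algHom_C]
      linear_combination (z * β' 1 + r * z * β' 3) * h.sq_s +
        (α' 1 + s * β' 1 + r * (α' 3 + s * β' 3)) * h.sq_q
    · refine ⟨![α 2 * U - β 2 * Z * S, α 3 * U - β 3 * Z * S, α 0, α 1],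
        ![-α 2 * Z + β 2 * U, -α 3 * Z + β 3 * U, β 0, β 1], fun {R} _ _ {q r s t z} h => ?_⟩
      rw [map_mul, hG h]
      generalize hα : (fun i => (aeval ![t, z]) (α i)) = α' at *
      generalize hβ : (fun i => (aeval ![t, z]) (β i)) = β' at *
      have hα' := fun i => congrFun hα i
      have hβ' := fun i => congrFun hβ i
      simp [octicComb, U, S, T, Z, hα', hβ', algHom_C]
      linear_combination -(z * β' 2 + q * z * β' 3) * h.sq_s +
        (α' 2 + s * β' 2 + q * (α' 3 + s * β' 3)) * h.sq_r
    · refine ⟨fun i => β i * S, α, fun {R} _ _ {q r s t z} h => ?_⟩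
      rw [map_mul, hG h]
      generalize hα : (fun i => (aeval ![t, z]) (α i)) = α' at *
      generalize hβ : (fun i => (aeval ![t, z]) (β i)) = β' at *
      have hα' := fun i => congrFun hα i
      have hβ' := fun i => congrFun hβ i
      simp [octicComb, S, T, Z, hβ', algHom_C]
      linear_combination (β' 0 + β' 1 * q + β' 2 * r + β' 3 * (q * r)) * h.sq_s
    · refine ⟨fun i => α i * T, fun i => β i * T, fun h => ?_⟩
      rw [map_mul, hG h]
      simp [octicComb, T]
      ring
    · refine ⟨fun i => α i * Z, fun i => β i * Z, fun h => ?_⟩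
      rw [map_mul, hG h]
      simp [octicComb, Z]
      ring

variable {k : Type u} [Field k]

/-- The substitution `t ↦ tλ, z ↦ λ`. -/
noncomputable def homogSubst (k : Type u) [Field k] :
    MvPolynomial (Fin 2) k →ₐ[k] Polynomial (Polynomial k) :=
  aeval ![Polynomial.C Polynomial.X * Polynomial.X, Polynomial.X]

theorem map_homogSubst {K : Type*} [Field K] [Algebra k K] (t : K) (c : MvPolynomial (Fin 2) k) :
    aeval ![Polynomial.C t * Polynomial.X, (Polynomial.X : Polynomial K)] c =
      (homogSubst k c).map ((Polynomial.aeval t : Polynomial k →ₐ[k] K) : Polynomial k →+* K) := by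
  have : aeval ![Polynomial.C t * Polynomial.X, (Polynomial.X : Polynomial K)] =
      (Polynomial.mapAlgHom (Polynomial.aeval t : Polynomial k →ₐ[k] K)).comp
        (homogSubst k) := by
    ext i
    fin_cases i <;> simp [homogSubst]
  rw [this]
  rfl

theorem homogSubst_injective [Infinite k] : Function.Injective (homogSubst k) := by
  rw [injective_iff_map_eq_zero]
  intro c hc
  -- The substitution only reaches points with `z ≠ 0`; the factor `z` takes care of the others.
  have h : c * X 1 = 0 := by
    refine MvPolynomial.funext fun v => ?_
    rw [map_mul, eval_X, map_zero]
    rcases eq_or_ne (v 1) 0 with h0 | h0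
    · rw [h0, mul_zero]
    have hcomp : ((Polynomial.aeval (v 1)).comp
        (Polynomial.mapAlgHom (Polynomial.aeval (v 0 / v 1) : Polynomial k →ₐ[k] k))).comp
          (homogSubst k) = aeval v := by
      ext i
      fin_cases i
      · simp [homogSubst, h0]
      · simp [homogSubst]
    have := congrArg (fun φ => φ c) hcomp
    simp only [AlgHom.comp_apply, hc, map_zero] at this
    rw [aeval_eq_eval] at this
    change 0 = eval v c at this
    rw [← this, zero_mul]
  exact (mul_eq_zero.1 h).resolve_right (X_ne_zero 1)

/-- Evaluation at the generic point of the affine cone. -/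
noncomputable def genericEval {K : Type*} [Field K] [Algebra k K] (q r s t : K) :
    MvPolynomial (Fin (4 + 1)) k →ₐ[k] Polynomial K :=
  aeval ![Polynomial.C q * Polynomial.X, Polynomial.C r * Polynomial.X,
    Polynomial.C s * Polynomial.X, Polynomial.C t * Polynomial.X, Polynomial.X]

theorem is224Point_generic {K : Type*} [Field K] [Algebra k K] {a : k} {q r s t : K}
    (h : Is224Point a q r s t 1) :
    Is224Point a (Polynomial.C q * Polynomial.X) (Polynomial.C r * Polynomial.X)
      (Polynomial.C s * Polynomial.X) (Polynomial.C t * Polynomial.X) Polynomial.X := by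
  have ha : algebraMap k (Polynomial K) a = Polynomial.C (algebraMap k K a) := rfl
  obtain ⟨h1, h2, h3⟩ := h
  constructor
  · rw [mul_pow, ← map_pow, h1, ha]
    simp
    ring
  · rw [mul_pow, ← map_pow, h2, ha]
    simp
    ring
  · rw [mul_pow, ← map_pow, h3, ha]
    simp
    ring

/-- Independence of the eight monomials makes the whole normal form of `G` zero, and that form
computes `G` at every solution. -/
theorem aeval_eq_zero_of_genericEval_eq_zero [Infinite k] {K : Type u} [Field K] [Algebra k K]
    {a : k} {q r s t : K} (h : Is224Point a q r s t 1)
    (hind : ∀ α β : Fin 4 → Polynomial k, octicComb q r s (fun i => Polynomial.aeval t (α i))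
      (fun i => Polynomial.aeval t (β i)) = 0 → α = 0 ∧ β = 0)
    {G : MvPolynomial (Fin (4 + 1)) k} (hG : genericEval q r s t G = 0)
    {R : Type u} [CommRing R] [Algebra k R] {q' r' s' t' z' : R}
    (h' : Is224Point a q' r' s' t' z') : aeval ![q', r', s', t', z'] G = 0 := by
  obtain ⟨α, β, hform⟩ := exists_octic_form a G
  have h1 : genericEval q r s t G = _ := hform (is224Point_generic h)
  rw [hG] at h1
  simp only [map_homogSubst] at h1
  -- Degrees of `1, q, r, qr` in the cone variable; a factor `s` adds one more.
  let e : Fin 4 → ℕ := ![0, 1, 1, 2]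
  let φ : Polynomial k →+* K := (Polynomial.aeval t : Polynomial k →ₐ[k] K)
  let A : Fin 4 → Polynomial K := fun i =>
    (homogSubst k (α i) * Polynomial.X ^ e i).map φ
  let B : Fin 4 → Polynomial K := fun i =>
    (homogSubst k (β i) * Polynomial.X ^ (e i + 1)).map φ
  have key : ∀ n, (fun i => (homogSubst k (α i) * Polynomial.X ^ e i).coeff n) = 0 ∧
      (fun i => (homogSubst k (β i) * Polynomial.X ^ (e i + 1)).coeff n) = 0 := by
    intro n
    apply hind
    have h2 := congrArg (fun P => Polynomial.coeff P n) (show (0 : Polynomial K) =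
      (A 0 + Polynomial.C s * B 0) + Polynomial.C q * (A 1 + Polynomial.C s * B 1) +
        Polynomial.C r * (A 2 + Polynomial.C s * B 2) +
        Polynomial.C (q * r) * (A 3 + Polynomial.C s * B 3) by
      rw [h1]
      simp [octicComb, A, B, e, φ]
      ring)
    simp only [Polynomial.coeff_zero, Polynomial.coeff_add, Polynomial.coeff_C_mul, A, B,
      Polynomial.coeff_map, φ, RingHom.coe_coe] at h2
    rw [octicComb, h2]
    ring
  have hα : ∀ i, α i = 0 := fun i => by
    have : homogSubst k (α i) * Polynomial.X ^ e i = 0 :=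
      Polynomial.ext fun n => congrFun (key n).1 i
    exact homogSubst_injective (by
      rw [(mul_eq_zero.1 this).resolve_right (pow_ne_zero _ Polynomial.X_ne_zero), map_zero])
  have hβ : ∀ i, β i = 0 := fun i => by
    have : homogSubst k (β i) * Polynomial.X ^ (e i + 1) = 0 :=
      Polynomial.ext fun n => congrFun (key n).2 i
    exact homogSubst_injective (by
      rw [(mul_eq_zero.1 this).resolve_right (pow_ne_zero _ Polynomial.X_ne_zero), map_zero])
  rw [hform h']
  simp [hα, hβ, octicComb]

theorem mem_affineCone_C224 (a : k) (v : Fin (4 + 1) → k) :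
    v ∈ affineCone (C224 a) ↔ Is224Point a (v 0) (v 1) (v 2) (v 3) (v 4) := by
  have hC : ∀ P : ℙ k (Fin (4 + 1) → k), P ∈ C224 a ↔
      ∀ v ∈ P.submodule, Is224Point a (v 0) (v 1) (v 2) (v 3) (v 4) := by
    intro P
    simp only [C224, projZeroLocus, Set.mem_insert_iff, Set.mem_singleton_iff, forall_eq_or_imp,
      forall_eq, Set.mem_ofPred_eq]
    constructor
    · rintro ⟨h1, h2, h3⟩ v hv
      have h1 := h1 v hv
      have h2 := h2 v hv
      have h3 := h3 v hv
      simp at h1 h2 h3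
      constructor <;> simp only [Algebra.algebraMap_self, RingHom.id_apply]
      · linear_combination h1
      · linear_combination h2
      · linear_combination h3
    · intro h
      refine ⟨fun v hv => ?_, fun v hv => ?_, fun v hv => ?_⟩
      · have := (h v hv).sq_s
        simp at this ⊢
        linear_combination this
      · have := (h v hv).sq_q
        simp at this ⊢
        linear_combination this
      · have := (h v hv).sq_r
        simp at this ⊢
        linear_combination this
  have hpoint : ∀ v : Fin (4 + 1) → k, v ≠ 0 → Is224Point a (v 0) (v 1) (v 2) (v 3) (v 4) →
      v ∈ affineCone (C224 a) := by
    intro v hv h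
    refine ⟨Projectivization.mk k v hv, (hC _).2 fun u hu => ?_, ?_⟩
    · rw [Projectivization.submodule_mk, Submodule.mem_span_singleton] at hu
      obtain ⟨c, rfl⟩ := hu
      obtain ⟨h1, h2, h3⟩ := h
      constructor <;> simp only [Pi.smul_apply, smul_eq_mul]
      · linear_combination c ^ 2 * h1
      · linear_combination c ^ 2 * h2
      · linear_combination c ^ 2 * h3
    · rw [Projectivization.submodule_mk]
      exact Submodule.mem_span_singleton_self v
  constructor
  · rintro ⟨P, hP, hv⟩
    exact (hC P).1 hP v hv
  · intro h
    rcases eq_or_ne v 0 with rfl | hv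
    -- The zero vector lies in the cone only because the curve is nonempty; this point at infinity
    -- lies on every fiber.
    · obtain ⟨P, hP, -⟩ := hpoint ![1, 1, 1, 1, 0] (fun h => by simpa using congrFun h 0)
        ⟨by simp, by simp, by simp⟩
      exact ⟨P, hP, zero_mem _⟩
    · exact hpoint v hv h

omit [Field k] in
theorem vec_eta (v : Fin (4 + 1) → k) : ![v 0, v 1, v 2, v 3, v 4] = v := by
  ext i
  fin_cases i <;> rfl

theorem affineCone_C224_eq_zeroLocus (a : k) : affineCone (C224 a) = zeroLocus k (Ideal.span
    ({X 2 ^ 2 - (X 3 ^ 2 + X 3 * X 4 - C a * X 4 ^ 2),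
      X 0 ^ 2 - (X 3 ^ 2 - C a * X 4 ^ 2 + X 2 * X 4),
      X 1 ^ 2 - (X 3 ^ 2 - C a * X 4 ^ 2 - X 2 * X 4)} :
        Set (MvPolynomial (Fin (4 + 1)) k))) := by
  ext v
  rw [mem_affineCone_C224, zeroLocus_span]
  simp only [Set.mem_insert_iff, Set.mem_singleton_iff, forall_eq_or_imp, forall_eq,
    Set.mem_ofPred_eq, map_sub, map_add, map_mul, map_pow, aeval_X, algHom_C, sub_eq_zero]
  exact ⟨fun h => ⟨h.1, h.2, h.3⟩, fun h => ⟨h.1, h.2.1, h.2.2⟩⟩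

variable [IsAlgClosed k]

/-- The ideal is the kernel of a map to a domain. The Nullstellensatz gives it as the radical of the
three quadrics, which lies in the prime kernel; the normal form gives the reverse inclusion. -/
theorem projIdeal_C224_isPrime {K : Type u} [Field K] [Algebra k K]
    {a : k} {q r s t : K} (h : Is224Point a q r s t 1)
    (hind : ∀ α β : Fin 4 → Polynomial k, octicComb q r s (fun i => Polynomial.aeval t (α i))
      (fun i => Polynomial.aeval t (β i)) = 0 → α = 0 ∧ β = 0) :
    (projIdeal (C224 a)).IsPrime := by
  have hker : projIdeal (C224 a) = RingHom.ker (genericEval (k := k) q r s t) := by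
    apply le_antisymm
    · rw [projIdeal, affineCone_C224_eq_zeroLocus, vanishingIdeal_zeroLocus_eq_radical]
      refine (Ideal.IsPrime.radical_le_iff (RingHom.ker_isPrime _)).2 ?_
      rw [Ideal.span_le]
      have hg := is224Point_generic h
      rintro G (rfl | rfl | rfl) <;>
        simp only [SetLike.mem_coe, RingHom.mem_ker, map_sub, sub_eq_zero, map_add, map_mul,
          map_pow, genericEval, aeval_X, algHom_C]
      · exact hg.sq_s
      · exact hg.sq_q
      · exact hg.sq_r
    · intro G hG
      rw [projIdeal, mem_vanishingIdeal_iff]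
      intro v hv
      rw [← vec_eta v]
      exact aeval_eq_zero_of_genericEval_eq_zero h hind hG ((mem_affineCone_C224 a v).1 hv)
  rw [hker]
  exact RingHom.ker_isPrime _

end HomogeneousIdeal

/-! ### The function field of the 224 curve -/

section FunctionField

open IntermediateField

variable {k : Type u} [Field k] [IsAlgClosed k]

theorem exists_algebraMap_eq_of_not_transcendental {K : Type*} [Field K] [Algebra k K] {x : K}
    (hx : ¬ Transcendental k x) : ∃ c : k, algebraMap k K c = x := by
  have hx' : IsIntegral k x := (not_not.1 hx : IsAlgebraic k x).isIntegral
  exact minpoly.mem_range_of_degree_eq_one k x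
    (IsAlgClosed.degree_eq_one_of_irreducible k (minpoly.irreducible hx'))

theorem exists_is224Point (a t : k) : ∃ q r s : k, Is224Point a q r s t 1 := by
  obtain ⟨s, hs⟩ := IsAlgClosed.exists_pow_nat_eq
    (t ^ 2 + t * 1 - algebraMap k k a * 1 ^ 2) (n := 2) two_pos
  obtain ⟨q, hq⟩ := IsAlgClosed.exists_pow_nat_eq
    (t ^ 2 - algebraMap k k a * 1 ^ 2 + s * 1) (n := 2) two_pos
  obtain ⟨r, hr⟩ := IsAlgClosed.exists_pow_nat_eq
    (t ^ 2 - algebraMap k k a * 1 ^ 2 - s * 1) (n := 2) two_pos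
  exact ⟨q, r, s, hs, hq, hr⟩

theorem exists_mem_affineCone (a t : k) :
    ∃ v ∈ affineCone (C224 a), v 3 = t ∧ v 4 = 1 := by
  obtain ⟨q, r, s, h⟩ := exists_is224Point a t
  exact ⟨![q, r, s, t, 1], (mem_affineCone_C224 a _).2 h, rfl, rfl⟩

/-- Dehomogenize at `z`. The function `t/z` is transcendental because it takes every value in `k`: a
relation for it, homogenized, would be a polynomial vanishing on all of `k`. -/
theorem exists_projFunctionField_generators (a : k) [(projIdeal (C224 a)).IsPrime] :
    ∃ q r s t : FractionRing (HomogCoordRing (C224 a)), Is224Point a q r s t 1 ∧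
      Transcendental k t ∧ projFunctionField (C224 a) = adjoin k {q, r, s, t} := by
  let φ : MvPolynomial (Fin (4 + 1)) k →ₐ[k] (FractionRing (HomogCoordRing (C224 a))) :=
    (IsScalarTower.toAlgHom k (HomogCoordRing (C224 a))
      (FractionRing (HomogCoordRing (C224 a)))).comp
      (Ideal.Quotient.mkₐ k (projIdeal (C224 a)))
  have hφ : ∀ G, φ G = 0 ↔ ∀ v ∈ affineCone (C224 a), aeval v G = 0 := by
    intro G
    rw [← mem_vanishingIdeal_iff]
    change algebraMap (HomogCoordRing (C224 a)) (FractionRing (HomogCoordRing (C224 a)))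
      (Ideal.Quotient.mk _ G) = 0 ↔ _
    rw [map_eq_zero_iff _ (IsFractionRing.injective (HomogCoordRing (C224 a))
      (FractionRing (HomogCoordRing (C224 a)))),
      Ideal.Quotient.eq_zero_iff_mem]
    rfl
  have hz : φ (X 4) ≠ 0 := fun h => by
    obtain ⟨v, hv, -, h1⟩ := exists_mem_affineCone a 0
    have := (hφ _).1 h v hv
    rw [aeval_X, h1] at this
    exact one_ne_zero this
  have hrel : Is224Point a (φ (X 0)) (φ (X 1)) (φ (X 2)) (φ (X 3)) (φ (X 4)) := by
    have key : ∀ G H : MvPolynomial (Fin (4 + 1)) k,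
        (∀ v ∈ affineCone (C224 a), aeval v G = aeval v H) → φ G = φ H := by
      intro G H h
      rw [← sub_eq_zero, ← map_sub, hφ]
      intro v hv
      rw [map_sub, h v hv, sub_self]
    have ha : algebraMap k (FractionRing (HomogCoordRing (C224 a))) a = φ (C a) :=
      (φ.commutes a).symm
    constructor
    · rw [ha]
      simp only [← map_pow, ← map_mul, ← map_add, ← map_sub]
      refine key _ _ fun v hv => ?_
      simpa using ((mem_affineCone_C224 a v).1 hv).sq_s
    · rw [ha]
      simp only [← map_pow, ← map_mul, ← map_add, ← map_sub]
      refine key _ _ fun v hv => ?_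
      simpa using ((mem_affineCone_C224 a v).1 hv).sq_q
    · rw [ha]
      simp only [← map_pow, ← map_mul, ← map_sub]
      refine key _ _ fun v hv => ?_
      simpa using ((mem_affineCone_C224 a v).1 hv).sq_r
  refine ⟨φ (X 0) / φ (X 4), φ (X 1) / φ (X 4), φ (X 2) / φ (X 4), φ (X 3) / φ (X 4),
    ?_, ?_, ?_⟩
  · obtain ⟨h1, h2, h3⟩ := hrel
    constructor <;> field_simp
    · linear_combination h1
    · linear_combination h2
    · linear_combination h3
  · rintro ⟨p, hp, hp0⟩
    apply hp
    have h1 : φ (∑ i ∈ Finset.range (p.natDegree + 1),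
        C (p.coeff i) * X 3 ^ i * X 4 ^ (p.natDegree - i)) = 0 := by
      have h2 : φ (X 4) ^ p.natDegree * Polynomial.aeval (φ (X 3) / φ (X 4)) p = 0 := by
        rw [hp0, mul_zero]
      rw [Polynomial.aeval_eq_sum_range, Finset.mul_sum] at h2
      rw [map_sum, ← h2]
      refine Finset.sum_congr rfl fun i hi => ?_
      have hi' : i ≤ p.natDegree := by simpa [Nat.lt_succ_iff] using hi
      have h3 : φ (X 4) ^ p.natDegree = φ (X 4) ^ (p.natDegree - i) * φ (X 4) ^ i := by
        rw [← pow_add, Nat.sub_add_cancel hi']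
      have h4 : φ (C (p.coeff i)) =
          algebraMap k (FractionRing (HomogCoordRing (C224 a))) (p.coeff i) :=
        φ.commutes _
      have h5 : ∀ c x y z : (FractionRing (HomogCoordRing (C224 a))), z ≠ 0 →
          c * x * y = y * z * (c * (x / z)) := by
        intro c x y z hz
        field_simp
      rw [map_mul, map_mul, map_pow, map_pow, h3, Algebra.smul_def, h4, div_pow]
      exact h5 _ _ _ _ (pow_ne_zero _ hz)
    refine Polynomial.funext fun t => ?_
    obtain ⟨v, hv, hv3, hv4⟩ := exists_mem_affineCone a t
    have := (hφ _).1 h1 v hv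
    simp only [map_sum, map_mul, map_pow, aeval_X, algHom_C, hv3, hv4, one_pow, mul_one] at this
    rw [Polynomial.eval_eq_sum_range, Polynomial.eval_zero]
    exact this
  · have hmem : ∀ i, φ (X i) / φ (X 4) ∈ adjoin k {φ (X 0) / φ (X 4), φ (X 1) / φ (X 4),
        φ (X 2) / φ (X 4), φ (X 3) / φ (X 4)} := by
      intro i
      fin_cases i
      · exact subset_adjoin k _ (by simp)
      · exact subset_adjoin k _ (by simp)
      · exact subset_adjoin k _ (by simp)
      · exact subset_adjoin k _ (by simp)
      · have : φ (X 4) / φ (X 4) = 1 := div_self hz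
        exact this ▸ one_mem _
    apply le_antisymm
    · rw [projFunctionField, adjoin_le_iff]
      rintro _ ⟨i, j, rfl⟩
      have := div_mem (hmem i) (hmem j)
      rwa [div_div_div_cancel_right₀ hz] at this
    · rw [adjoin_le_iff]
      rintro _ (rfl | rfl | rfl | rfl) <;> exact subset_adjoin k _ ⟨_, _, rfl⟩

theorem separable_quadratic {F : Type*} [Field F] [CharZero F] {b c : F}
    (h : b ^ 2 - 4 * c ≠ 0) :
    (Polynomial.X ^ 2 + Polynomial.C b * Polynomial.X + Polynomial.C c).Separable := by
  set δ := (b ^ 2 - 4 * c)⁻¹ with hδ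
  have h1 : Polynomial.C δ * (Polynomial.C b ^ 2 - 4 * Polynomial.C c) = 1 := by
    have : (Polynomial.C b ^ 2 - 4 * Polynomial.C c : Polynomial F) =
        Polynomial.C (b ^ 2 - 4 * c) := by
      rw [map_sub, map_mul, map_pow, Polynomial.C_ofNat]
    rw [this, ← map_mul, hδ, inv_mul_cancel₀ h, map_one]
  refine ⟨-4 * Polynomial.C δ, Polynomial.C δ * (2 * Polynomial.X + Polynomial.C b), ?_⟩
  simp only [Polynomial.derivative_add, Polynomial.derivative_X_pow, Polynomial.derivative_mul,
    Polynomial.derivative_X, Polynomial.derivative_C, Nat.cast_ofNat, Polynomial.C_ofNat]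
  linear_combination h1

/-- The hypothesis is nonvanishing of the resultant, obtained by dividing the first quadratic by the
difference of the two, which is linear. -/
theorem isCoprime_quadratic {F : Type*} [Field F] {b₁ c₁ b₂ c₂ : F}
    (h : (b₁ - b₂) ^ 2 * c₁ - (c₁ - c₂) * (b₁ * (b₁ - b₂) - (c₁ - c₂)) ≠ 0) :
    IsCoprime (Polynomial.X ^ 2 + Polynomial.C b₁ * Polynomial.X + Polynomial.C c₁)
      (Polynomial.X ^ 2 + Polynomial.C b₂ * Polynomial.X + Polynomial.C c₂) := by
  set δ := ((b₁ - b₂) ^ 2 * c₁ - (c₁ - c₂) * (b₁ * (b₁ - b₂) - (c₁ - c₂)))⁻¹ with hδ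
  have h1 := congrArg Polynomial.C (inv_mul_cancel₀ h)
  rw [← hδ] at h1
  simp only [map_mul, map_sub, map_pow, map_one] at h1
  refine ⟨Polynomial.C δ * ((Polynomial.C b₁ - Polynomial.C b₂) ^ 2 -
      ((Polynomial.C b₁ - Polynomial.C b₂) * Polynomial.X +
        Polynomial.C b₁ * (Polynomial.C b₁ - Polynomial.C b₂) -
          (Polynomial.C c₁ - Polynomial.C c₂))),
    Polynomial.C δ * ((Polynomial.C b₁ - Polynomial.C b₂) * Polynomial.X +
      Polynomial.C b₁ * (Polynomial.C b₁ - Polynomial.C b₂) -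
        (Polynomial.C c₁ - Polynomial.C c₂)), ?_⟩
  linear_combination h1

/-- Two layers: `1, A, B, AB` are independent over `k(w)`, which contains `s` and `t`; then `1, s`
are independent over `k(t)`, as `t² + t - a` has discriminant `1 + 4a ≠ 0`. -/
theorem octic_independent [CharZero k] {K : Type u} [Field K] [Algebra k K]
    {f g : Polynomial k} (hs : (f * g).Separable) (hf : 0 < f.natDegree) (hg : 0 < g.natDegree)
    {w A B : K} (h : IsBiquadratic f g w A B) {a : k} (ha : 1 + 4 * a ≠ 0) {d e s t : K}
    (hd : d ∈ k⟮w⟯) (he : e ∈ k⟮w⟯) (hd0 : d ≠ 0) (he0 : e ≠ 0) (hsw : s ∈ k⟮w⟯)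
    (htw : t ∈ k⟮w⟯) (ht : Transcendental k t) (hst : s ^ 2 = t ^ 2 + t - algebraMap k K a)
    (α β : Fin 4 → Polynomial k) (h0 : octicComb (d * A) (e * B) s
      (fun i => Polynomial.aeval t (α i)) (fun i => Polynomial.aeval t (β i)) = 0) :
    α = 0 ∧ β = 0 := by
  have : CharZero K := charZero_of_injective_algebraMap (algebraMap k K).injective
  have hp : ∀ p : Polynomial k, Polynomial.aeval t p ∈ k⟮w⟯ := fun p =>
    (IsBiquadratic.aeval_mem t p : Polynomial.aeval t p ∈ k⟮t⟯) |>
      (adjoin_simple_le_iff.2 htw ·)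
  have hl : ∀ i, Polynomial.aeval t (α i) + Polynomial.aeval t (β i) * s ∈ k⟮w⟯ := fun i =>
    add_mem (hp _) (mul_mem (hp _) hsw)
  have hzero : ∀ i, Polynomial.aeval t (α i) + Polynomial.aeval t (β i) * s = 0 := by
    obtain ⟨h1, h2, h3, h4⟩ := h.independent hs hf hg (hl 0) (mul_mem (hl 1) hd)
      (mul_mem (hl 2) he) (mul_mem (hl 3) (mul_mem hd he)) (by
        rw [octicComb] at h0
        linear_combination h0)
    intro i
    fin_cases i
    · exact h1
    · exact (mul_eq_zero.1 h2).resolve_right hd0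
    · exact (mul_eq_zero.1 h3).resolve_right he0
    · exact (mul_eq_zero.1 h4).resolve_right (mul_ne_zero hd0 he0)
  have hns : ∀ u ∈ k⟮t⟯, u ^ 2 ≠ s ^ 2 := fun u hu => by
    have hdeg : (Polynomial.X ^ 2 + Polynomial.C 1 * Polynomial.X +
        Polynomial.C (-a) : Polynomial k).natDegree = 2 := by
      compute_degree!
    have := sq_ne_aeval_of_separable ht (separable_quadratic
      (show (1 : k) ^ 2 - 4 * -a ≠ 0 by rwa [one_pow, mul_neg, sub_neg_eq_add]))
      (by rw [hdeg]; norm_num) hu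
    rw [hst]
    simpa [sub_eq_add_neg] using this
  have hinj := transcendental_iff_injective.1 ht
  constructor <;> funext i
  · exact hinj (by
      rw [(add_mul_eq_zero_of_sq_ne hns (IsBiquadratic.aeval_mem t _)
        (IsBiquadratic.aeval_mem t _) (hzero i)).1]
      simp)
  · exact hinj (by
      rw [(add_mul_eq_zero_of_sq_ne hns (IsBiquadratic.aeval_mem t _)
        (IsBiquadratic.aeval_mem t _) (hzero i)).2]
      simp)

theorem trdeg_and_rank_of_eq_adjoin [CharZero k] {f g : Polynomial k} (hs : (f * g).Separable)
    (hf : 0 < f.natDegree) (hg : 0 < g.natDegree) {M : Type u} [Field M] [Algebra k M]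
    {w A' B' : M} (h' : IsBiquadratic f g w A' B') {F : IntermediateField k M}
    (hF : F = adjoin k {w, A', B'}) :
    Algebra.trdeg k F = 1 ∧ Module.rank k (regularDifferentials k F) =
      (((f.natDegree - 1) / 2 + ((g.natDegree - 1) / 2 + ((f * g).natDegree - 1) / 2) : ℕ) :
        Cardinal) := by
  subst hF
  let w₁ : adjoin k {w, A', B'} := ⟨w, subset_adjoin k _ (by simp)⟩
  let A₁ : adjoin k {w, A', B'} := ⟨A', subset_adjoin k _ (by simp)⟩
  let B₁ : adjoin k {w, A', B'} := ⟨B', subset_adjoin k _ (by simp)⟩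
  have hv : ∀ p : Polynomial k, ((Polynomial.aeval w₁ p : adjoin k {w, A', B'}) : M) =
      Polynomial.aeval w p := fun p =>
    (Polynomial.aeval_algHom_apply (adjoin k {w, A', B'}).val w₁ p).symm
  have h₁ : IsBiquadratic f g w₁ A₁ B₁ := by
    refine ⟨fun ⟨p, hp, hp0⟩ => h'.transcendental ⟨p, hp, ?_⟩, Subtype.ext ?_, Subtype.ext ?_⟩
    · rw [← hv, hp0]
      rfl
    · rw [hv]
      exact h'.sq_left
    · rw [hv]
      exact h'.sq_right
  have htop : adjoin k {w₁, A₁, B₁} = ⊤ := by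
    apply IntermediateField.map_injective (adjoin k {w, A', B'}).val
    rw [adjoin_map, ← AlgHom.fieldRange_eq_map, fieldRange_val]
    congr 1
    simp [Set.image_insert_eq, w₁, A₁, B₁]
  exact ⟨trdeg_eq_one_of_isBiquadratic hs hf hg h₁ htop,
    rank_regularDifferentials_of_isBiquadratic hs hf hg h₁ htop⟩

/-- The function field is available only once the ideal is prime. So `hfrom` first builds a generic
point inside `k((T))` to prove primality, and `hto` then identifies the actual function field as
biquadratic. -/
theorem isIrreducibleCurveOfGenus_of_isBiquadratic [CharZero k] {a : k}
    (ha : 1 + 4 * a ≠ 0) {f g : Polynomial k} (hs : (f * g).Separable)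
    (hf : 0 < f.natDegree) (hg : 0 < g.natDegree)
    (hto : ∀ {M : Type u} [Field M] [Algebra k M] {q r s t : M}, Is224Point a q r s t 1 →
      Transcendental k t → ∃ w A B : M, IsBiquadratic f g w A B ∧
        adjoin k {q, r, s, t} = adjoin k {w, A, B})
    (hfrom : ∀ {M : Type u} [Field M] [Algebra k M] {w A B : M}, IsBiquadratic f g w A B →
      ∃ d ∈ k⟮w⟯, ∃ e ∈ k⟮w⟯, ∃ s ∈ k⟮w⟯, ∃ t ∈ k⟮w⟯, d ≠ 0 ∧ e ≠ 0 ∧ Transcendental k t ∧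
        Is224Point a (d * A) (e * B) s t 1) :
    IsIrreducibleCurveOfGenus (C224 a)
      ((f.natDegree - 1) / 2 + ((g.natDegree - 1) / 2 + ((f * g).natDegree - 1) / 2)) := by
  have hf0 : f ≠ 0 := by rintro rfl; simp at hf
  have hg0 : g ≠ 0 := by rintro rfl; simp at hg
  obtain ⟨A, B, h⟩ := isBiquadratic_pointExpansion hf0 hg0 (0 : k)
  obtain ⟨d, hd, e, he, s, hsw, t, htw, hd0, he0, ht, hpt⟩ := hfrom h
  have hprime : (projIdeal (C224 a)).IsPrime := projIdeal_C224_isPrime hpt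
    (octic_independent hs hf hg h ha hd he hd0 he0 hsw htw ht
      (by simpa using hpt.sq_s))
  obtain ⟨q', r', s', t', hpt', ht', hF⟩ := exists_projFunctionField_generators a
  obtain ⟨w, A', B', h', hadj⟩ := hto hpt' ht'
  rw [hadj] at hF
  exact ⟨hprime, trdeg_and_rank_of_eq_adjoin hs hf hg h' hF⟩

end FunctionField

/-! ### The special fibers -/

section SpecialFibers

open IntermediateField

theorem isCoprime_of_eq_C {F : Type*} [Field F] {p q u v : Polynomial F} {n : F} (hn : n ≠ 0)
    (h : u * p + v * q = Polynomial.C n) : IsCoprime p q := by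
  refine ⟨Polynomial.C n⁻¹ * u, Polynomial.C n⁻¹ * v, ?_⟩
  rw [mul_assoc, mul_assoc, ← mul_add, h, ← map_mul, inv_mul_cancel₀ hn, map_one]

theorem aeval_ne_zero_of_eval_ne_zero {k K : Type*} [Field k] [Field K] [Algebra k K] {w : K}
    (hw : Transcendental k w) (p : Polynomial k) (x : k) (hp : p.eval x ≠ 0) :
    Polynomial.aeval w p ≠ 0 := fun h => by
  have : p = 0 := by
    by_contra h0
    exact hw ⟨p, h0, h⟩
  simp [this] at hp

/-! ### The fiber over `0` -/

section NodalFiber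

/-- The polynomial `x³ - x + 1`. -/
noncomputable def cubicPlus (k : Type*) [Field k] : Polynomial k :=
  Polynomial.X ^ 3 - Polynomial.X + 1

/-- The polynomial `-x³ + x + 1`. -/
noncomputable def cubicMinus (k : Type*) [Field k] : Polynomial k :=
  -Polynomial.X ^ 3 + Polynomial.X + 1

variable {k : Type u} [Field k] [CharZero k]

theorem natDegree_cubicPlus : (cubicPlus k).natDegree = 3 := by
  rw [cubicPlus]
  compute_degree!

theorem natDegree_cubicMinus : (cubicMinus k).natDegree = 3 := by
  rw [cubicMinus]
  compute_degree!

/-- The cubics are exchanged by `x ↦ -x`, have discriminant `-23` up to sign, and add up to `2`,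
hence are coprime. -/
theorem separable_cubicPlus_mul_cubicMinus : (cubicPlus k * cubicMinus k).Separable := by
  refine Polynomial.Separable.mul ?_ ?_ ?_
  · refine isCoprime_of_eq_C (n := 23) (by norm_num) (u := 18 * Polynomial.X + 27)
      (v := 4 - 6 * Polynomial.X ^ 2 - 9 * Polynomial.X) ?_
    simp only [cubicPlus, Polynomial.derivative_add, Polynomial.derivative_sub,
      Polynomial.derivative_X_pow, Polynomial.derivative_X, Polynomial.derivative_one,
      Nat.cast_ofNat, Polynomial.C_ofNat]
    ring
  · refine isCoprime_of_eq_C (n := 23) (by norm_num) (u := 27 - 18 * Polynomial.X)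
      (v := -(4 - 6 * Polynomial.X ^ 2 + 9 * Polynomial.X)) ?_
    simp only [cubicMinus, Polynomial.derivative_add, Polynomial.derivative_neg,
      Polynomial.derivative_X_pow, Polynomial.derivative_X, Polynomial.derivative_one,
      Nat.cast_ofNat, Polynomial.C_ofNat]
    ring
  · refine isCoprime_of_eq_C (n := 2) (by norm_num) (u := 1) (v := 1) ?_
    simp only [cubicPlus, cubicMinus, Polynomial.C_ofNat]
    ring

variable [IsAlgClosed k]

theorem isIrreducibleCurveOfGenus_C224_zero : IsIrreducibleCurveOfGenus (C224 (0 : k)) 4 := by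
  have hf := natDegree_cubicPlus (k := k)
  have hg := natDegree_cubicMinus (k := k)
  have hf0 : cubicPlus k ≠ 0 := fun h => by simp [h] at hf
  have hg0 : cubicMinus k ≠ 0 := fun h => by simp [h] at hg
  have hfg : (cubicPlus k * cubicMinus k).natDegree = 6 := by
    rw [Polynomial.natDegree_mul hf0 hg0, hf, hg]
  have main := isIrreducibleCurveOfGenus_of_isBiquadratic (a := (0 : k)) (f := cubicPlus k)
    (g := cubicMinus k) (by simp) separable_cubicPlus_mul_cubicMinus (by omega) (by omega) ?_ ?_
  · rwa [hf, hg, hfg] at main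
  · intro M _ _ q r s t h ht
    have ht0 : t ≠ 0 := fun h0 => ht (h0 ▸ isAlgebraic_zero)
    obtain ⟨h1, h2, h3⟩ := h
    simp only [map_zero, mul_one, sub_zero, one_pow] at h1 h2 h3
    have htw : (s / t) ^ 2 - 1 = t⁻¹ := by
      field_simp
      linear_combination h1
    refine ⟨s / t, q / t, r / t, ⟨?_, ?_, ?_⟩, ?_⟩
    · by_contra hw
      obtain ⟨c, hc⟩ := exists_algebraMap_eq_of_not_transcendental hw
      apply ht
      rw [← inv_inv t, ← htw, ← hc, ← map_pow, ← map_one (algebraMap k M), ← map_sub, ← map_inv₀]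
      exact isAlgebraic_algebraMap _
    · simp only [cubicPlus, map_add, map_sub, map_pow, Polynomial.aeval_X, map_one]
      field_simp
      linear_combination t * h2 - s * h1
    · simp only [cubicMinus, map_add, map_neg, map_pow, Polynomial.aeval_X, map_one]
      field_simp
      linear_combination t * h3 + s * h1
    · set L := adjoin k {s / t, q / t, r / t} with hL
      have hwL : s / t ∈ L := subset_adjoin k _ (by simp)
      have hAL : q / t ∈ L := subset_adjoin k _ (by simp)
      have hBL : r / t ∈ L := subset_adjoin k _ (by simp)
      have htL : t ∈ L := by
        rw [← inv_inv t, ← htw]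
        exact inv_mem (sub_mem (pow_mem hwL 2) (one_mem _))
      apply le_antisymm
      · rw [adjoin_le_iff]
        have hmul : ∀ x, x / t ∈ L → x ∈ L := fun x hx => by
          rw [← div_mul_cancel₀ x ht0]
          exact mul_mem hx htL
        rintro _ (rfl | rfl | rfl | rfl)
        exacts [hmul _ hAL, hmul _ hBL, hmul _ hwL, htL]
      · rw [hL, adjoin_le_iff]
        have hgen : ∀ x ∈ ({q, r, s, t} : Set M), x ∈ adjoin k {q, r, s, t} :=
          fun x hx => subset_adjoin k _ hx
        rintro _ (rfl | rfl | rfl) <;> exact div_mem (hgen _ (by simp)) (hgen _ (by simp))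
  · intro M _ _ w A B h
    have hw : w ^ 2 - 1 ≠ 0 := by
      have := aeval_ne_zero_of_eval_ne_zero h.transcendental (Polynomial.X ^ 2 - 1) 0 (by simp)
      simpa using this
    have hwE := mem_adjoin_simple_self k w
    have htE : (w ^ 2 - 1)⁻¹ ∈ k⟮w⟯ := inv_mem (sub_mem (pow_mem hwE 2) (one_mem _))
    have hA := h.sq_left
    have hB := h.sq_right
    simp only [cubicPlus, cubicMinus, map_add, map_sub, map_neg, map_pow, Polynomial.aeval_X,
      map_one] at hA hB
    refine ⟨_, htE, _, htE, w * (w ^ 2 - 1)⁻¹, mul_mem hwE htE, _, htE, inv_ne_zero hw,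
      inv_ne_zero hw, ?_, ?_, ?_, ?_⟩
    · by_contra ht
      obtain ⟨c, hc⟩ := exists_algebraMap_eq_of_not_transcendental ht
      have := aeval_ne_zero_of_eval_ne_zero h.transcendental
        (Polynomial.C c * (Polynomial.X ^ 2 - 1) - 1) 1 (by simp)
      apply this
      simp [hc, hw]
    · simp only [map_zero]
      field_simp
      ring
    · simp only [map_zero]
      field_simp
      linear_combination hA
    · simp only [map_zero]
      field_simp
      linear_combination hB

end NodalFiber

/-! ### Third critical values and their fibers -/

section CriticalFiber

variable {k : Type u} [Field k] [CharZero k]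

/-- The formula for `a` is the remainder of the quartic `f_c³(0)` on division by its derivative in
`c`. -/
theorem isCriticalValue_three_iff {a : k} : IsCriticalValue 3 a ↔
    ∃ c : k, 4 * c ^ 3 + 6 * c ^ 2 + 2 * c + 1 = 0 ∧ a = -c ^ 2 / 4 + c / 2 - 1 / 8 := by
  refine exists_congr fun c => ?_
  have h1 : (quadMap c)^[3] 0 = c ^ 4 + 2 * c ^ 3 + c ^ 2 + c := by
    simp only [Function.iterate_succ, Function.iterate_zero, Function.comp_apply, id, quadMap]
    ring
  have h2 : (Polynomial.derivative ((quadMap (Polynomial.X : Polynomial k))^[3] 0)).eval c =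
      4 * c ^ 3 + 6 * c ^ 2 + 2 * c + 1 := by
    simp [Function.iterate_succ, quadMap, Polynomial.derivative_pow]
    ring
  rw [h1, h2, and_comm]
  refine and_congr_right fun h => ?_
  have h3 : c ^ 4 + 2 * c ^ 3 + c ^ 2 + c = -c ^ 2 / 4 + c / 2 - 1 / 8 := by
    linear_combination (1 / 8 + c / 4) * h
  rw [h3, eq_comm]

/-- The cubic for `c` has three distinct roots, and distinct roots give distinct values: equal
values would force `c + d = 2` and `cd = 15/2`, which is incompatible with the cubic. -/
theorem ncard_isCriticalValue_three [IsAlgClosed k] : {a : k | IsCriticalValue 3 a}.ncard = 3 := by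
  let p : Polynomial k := 4 * Polynomial.X ^ 3 + 6 * Polynomial.X ^ 2 + 2 * Polynomial.X + 1
  have hdeg : p.natDegree = 3 := by
    simp only [p]
    compute_degree!
  have hp0 : p ≠ 0 := fun h => by simp [h] at hdeg
  have hsep : p.Separable := by
    refine isCoprime_of_eq_C (n := 26) (by norm_num) (u := 18 * Polynomial.X + 36)
      (v := 1 - (3 * Polynomial.X + 6) * (2 * Polynomial.X + 1)) ?_
    simp only [p, Polynomial.derivative_add, Polynomial.derivative_mul,
      Polynomial.derivative_X_pow, Polynomial.derivative_X, Polynomial.derivative_one,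
      Polynomial.derivative_ofNat, Nat.cast_ofNat, Polynomial.C_ofNat]
    ring
  classical
  have hset : {a : k | IsCriticalValue 3 a} =
      (fun c => -c ^ 2 / 4 + c / 2 - 1 / 8) '' (p.roots.toFinset : Set k) := by
    ext a
    rw [Set.mem_ofPred_eq, isCriticalValue_three_iff]
    refine exists_congr fun c => ?_
    simp [hp0, p, Polynomial.IsRoot, eq_comm (a := a)]
  rw [hset, Set.InjOn.ncard_image, Set.ncard_coe_finset,
    Multiset.toFinset_card_of_nodup (Polynomial.nodup_roots hsep), ← hdeg]
  · exact (IsAlgClosed.splits p).natDegree_eq_card_roots.symm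
  · intro c hc d hd hcd
    simp only [Finset.mem_coe, Multiset.mem_toFinset, Polynomial.mem_roots hp0, p,
      Polynomial.IsRoot, Polynomial.eval_add, Polynomial.eval_mul, Polynomial.eval_pow,
      Polynomial.eval_X, Polynomial.eval_ofNat, Polynomial.eval_one] at hc hd
    by_contra hne
    have hne' : c - d ≠ 0 := sub_ne_zero.2 hne
    dsimp only at hcd
    have h1 : d = 2 - c := by
      have : (c - d) * (c + d - 2) = 0 := by linear_combination -4 * hcd
      linear_combination (mul_eq_zero.1 this).resolve_left hne'
    subst h1
    have h2 : (c - (2 - c)) * (c * (2 - c) - 15 / 2) = 0 := by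
      linear_combination (-1 / 4) * hc + (1 / 4) * hd
    have h3 := (mul_eq_zero.1 h2).resolve_left hne'
    have h4 : (1 : k) = 0 := by
      linear_combination (-1 / 104) * hc - (4 * c + 14) / 104 * h3
    exact one_ne_zero h4

/-- The quadratic factor of `q²`. -/
noncomputable def criticalQuadraticLeft {k : Type*} [Field k] (c : k) : Polynomial k :=
  Polynomial.X ^ 2 + Polynomial.C (2 - 2 * c ^ 2) * Polynomial.X +
    Polynomial.C (7 / 4 * c ^ 2 + c / 2 - 13 / 8)

/-- The quadratic factor of `r²`. -/
noncomputable def criticalQuadraticRight {k : Type*} [Field k] (c : k) : Polynomial k :=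
  Polynomial.X ^ 2 + Polynomial.C (-2 * c ^ 2 - 4 * c - 2) * Polynomial.X +
    Polynomial.C (15 / 4 * c ^ 2 + 5 / 2 * c + 11 / 8)

theorem separable_criticalQuadratic_mul {c : k}
    (hc : 4 * c ^ 3 + 6 * c ^ 2 + 2 * c + 1 = 0) :
    (criticalQuadraticLeft c * criticalQuadraticRight c).Separable := by
  refine Polynomial.Separable.mul (separable_quadratic fun h => one_ne_zero (α := k) ?_)
    (separable_quadratic fun h => one_ne_zero (α := k) ?_)
    (isCoprime_quadratic fun h => one_ne_zero (α := k) ?_)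
  -- In each of the three cases the factor of `h` is the inverse of the discriminant or resultant
  -- modulo the cubic satisfied by `c`.
  · linear_combination (-1 / 8 - c / 4 - c ^ 2) * h -
      (-37 / 16 + 9 / 4 * c + 5 / 4 * c ^ 2 - c ^ 3) * hc
  · linear_combination (-3 / 8 - c / 4) * h - (-7 / 16 - c - c ^ 2 / 4) * hc
  · linear_combination (21 / 92 + 12 / 23 * c + 7 / 23 * c ^ 2) * h -
      (55 / 92 + 197 / 46 * c + 86 / 23 * c ^ 2 - 6 / 23 * c ^ 3 - 28 / 23 * c ^ 4) * hc

variable [IsAlgClosed k]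

theorem isIrreducibleCurveOfGenus_C224_of_isCriticalValue {a : k} (ha : IsCriticalValue 3 a) :
    IsIrreducibleCurveOfGenus (C224 a) 1 := by
  obtain ⟨c, hc, ha⟩ := isCriticalValue_three_iff.1 ha
  have hf : (criticalQuadraticLeft c).natDegree = 2 := by
    rw [criticalQuadraticLeft]
    compute_degree!
  have hg : (criticalQuadraticRight c).natDegree = 2 := by
    rw [criticalQuadraticRight]
    compute_degree!
  have hf0 : criticalQuadraticLeft c ≠ 0 := fun h => by simp [h] at hf
  have hg0 : criticalQuadraticRight c ≠ 0 := fun h => by simp [h] at hg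
  have hfg : (criticalQuadraticLeft c * criticalQuadraticRight c).natDegree = 4 := by
    rw [Polynomial.natDegree_mul hf0 hg0, hf, hg]
  -- The conic `s² = t² + t - a` is nondegenerate; the factor of `h` inverts `1 + 4a` modulo the
  -- cubic.
  have ha4 : 1 + 4 * a ≠ 0 := fun h => one_ne_zero (α := k) (by
    rw [ha] at h
    linear_combination (-1 / 4 - 5 / 2 * c - 2 * c ^ 2) * h - (-9 / 8 + c / 2) * hc)
  have hK : ∀ {K : Type u} [Field K] [Algebra k K], CharZero K := fun {K} _ _ =>
    charZero_of_injective_algebraMap (algebraMap k K).injective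
  have hcK : ∀ {K : Type u} [Field K] [Algebra k K], 4 * algebraMap k K c ^ 3 +
      6 * algebraMap k K c ^ 2 + 2 * algebraMap k K c + 1 = 0 := fun {K} _ _ => by
    have := congrArg (algebraMap k K) hc
    simpa only [map_add, map_mul, map_pow, map_ofNat, map_one, map_zero] using this
  have haK : ∀ {K : Type u} [Field K] [Algebra k K], algebraMap k K a =
      -algebraMap k K c ^ 2 / 4 + algebraMap k K c / 2 - 1 / 8 := fun {K} _ _ => by
    rw [ha]
    simp only [map_add, map_sub, map_neg, map_div₀, map_pow, map_ofNat, map_one]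
  have hfK : ∀ {K : Type u} [Field K] [Algebra k K] (w : K),
      Polynomial.aeval w (criticalQuadraticLeft c) = w ^ 2 + (2 - 2 * algebraMap k K c ^ 2) * w +
        (7 / 4 * algebraMap k K c ^ 2 + algebraMap k K c / 2 - 13 / 8) := fun {K} _ _ w => by
    simp only [criticalQuadraticLeft, map_add, map_sub, map_div₀, map_mul, map_pow, map_ofNat,
      Polynomial.aeval_X, Polynomial.aeval_C]
  have hgK : ∀ {K : Type u} [Field K] [Algebra k K] (w : K),
      Polynomial.aeval w (criticalQuadraticRight c) =
        w ^ 2 + (-2 * algebraMap k K c ^ 2 - 4 * algebraMap k K c - 2) * w +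
        (15 / 4 * algebraMap k K c ^ 2 + 5 / 2 * algebraMap k K c + 11 / 8) :=
    fun {K} _ _ w => by
      simp only [criticalQuadraticRight, map_add, map_sub, map_neg, map_div₀, map_mul, map_pow,
        map_ofNat, Polynomial.aeval_X, Polynomial.aeval_C]
  -- The left side is `(1 - 2w)² q²` for `t = (w² + a)/(1 - 2w)` and `s = t + w`. Its double root is
  -- the critical point `s = c`, `t = c² + c`, where `w = s - t = -c²`. For `r` below it is `s = -c`
  -- with the same `t`, where `w = -c² - 2c`.
  have hQ : ∀ {K : Type u} [Field K] [Algebra k K] (w : K),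
      (w ^ 2 + algebraMap k K a) ^ 2 + (algebraMap k K a + w - w ^ 2) * (1 - 2 * w) -
        algebraMap k K a * (1 - 2 * w) ^ 2 =
      (w + algebraMap k K c ^ 2) ^ 2 * Polynomial.aeval w (criticalQuadraticLeft c) :=
    fun {K} _ _ w => by
      have := hK (K := K)
      have h := hcK (K := K)
      rw [hfK, haK]
      generalize algebraMap k K c = γ at *
      linear_combination (1 / 64 + 3 / 4 * w - 9 / 8 * w ^ 2 - 5 / 32 * γ - 1 / 2 * γ * w +
        3 / 4 * γ * w ^ 2 + 17 / 32 * γ ^ 2 - 3 / 4 * γ ^ 2 * w - 7 / 16 * γ ^ 3 +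
        1 / 2 * γ ^ 3 * w) * h
  have hR : ∀ {K : Type u} [Field K] [Algebra k K] (w : K),
      (w ^ 2 + algebraMap k K a) ^ 2 - (algebraMap k K a + w - w ^ 2) * (1 - 2 * w) -
        algebraMap k K a * (1 - 2 * w) ^ 2 =
      (w + (algebraMap k K c ^ 2 + 2 * algebraMap k K c)) ^ 2 *
        Polynomial.aeval w (criticalQuadraticRight c) :=
    fun {K} _ _ w => by
      have := hK (K := K)
      have h := hcK (K := K)
      rw [hgK, haK]
      generalize algebraMap k K c = γ at *
      linear_combination (17 / 64 - 7 / 4 * w + 15 / 8 * w ^ 2 - 53 / 32 * γ + γ * w +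
        3 / 4 * γ * w ^ 2 - 95 / 32 * γ ^ 2 + 9 / 4 * γ ^ 2 * w - 15 / 16 * γ ^ 3 +
        1 / 2 * γ ^ 3 * w) * h
  have hne : ∀ {K : Type u} [Field K] [Algebra k K] {w : K}, Transcendental k w →
      1 - 2 * w ≠ 0 ∧ ∀ e : k, w + algebraMap k K e ≠ 0 := fun {K} _ _ {w} hw => by
    constructor
    · have := aeval_ne_zero_of_eval_ne_zero hw (1 - 2 * Polynomial.X) 0 (by simp)
      simpa only [map_sub, map_one, map_mul, map_ofNat, Polynomial.aeval_X] using this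
    · intro e
      have := aeval_ne_zero_of_eval_ne_zero hw (Polynomial.X + Polynomial.C e) (1 - e) (by simp)
      simpa using this
  have main := isIrreducibleCurveOfGenus_of_isBiquadratic (a := a) ha4
    (separable_criticalQuadratic_mul hc) (by omega) (by omega) ?_ ?_
  · rwa [hf, hg, hfg] at main
  · intro M _ _ q r s t h ht
    obtain ⟨h1, h2, h3⟩ := h
    simp only [mul_one, one_pow] at h1 h2 h3
    obtain ⟨w, hwdef⟩ : ∃ w, w = s - t := ⟨_, rfl⟩
    have hs : s = t + w := by rw [hwdef]; ring
    subst hs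
    have htw : t * (1 - 2 * w) = w ^ 2 + algebraMap k M a := by linear_combination -h1
    have hw : Transcendental k w := by
      by_contra hw
      obtain ⟨e, rfl⟩ := exists_algebraMap_eq_of_not_transcendental hw
      -- A constant `w = e` makes `t` constant, unless `e = 1/2`; that would require `a = -1/4`.
      by_cases he : 1 - 2 * e = 0
      · have h5 : algebraMap k M (e ^ 2 + a) = 0 := by
          rw [map_add, map_pow, ← htw]
          have := congrArg (algebraMap k M) he
          rw [map_sub, map_mul, map_one, map_ofNat, map_zero] at this
          rw [this, mul_zero]
        rw [map_eq_zero] at h5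
        exact ha4 (by linear_combination 4 * h5 + (1 + 2 * e) * he)
      · apply ht
        have he' : 1 - 2 * algebraMap k M e = algebraMap k M (1 - 2 * e) := by
          rw [map_sub, map_mul, map_one, map_ofNat]
        have : t = algebraMap k M ((e ^ 2 + a) / (1 - 2 * e)) := by
          rw [map_div₀, eq_div_iff ((map_ne_zero _).2 he), ← he', htw, map_add, map_pow]
        rw [this]
        exact isAlgebraic_algebraMap _
    obtain ⟨hu, hv⟩ := hne hw
    have hv1 := hv (c ^ 2)
    have hv2 := hv (c ^ 2 + 2 * c)
    simp only [map_add, map_mul, map_pow, map_ofNat] at hv1 hv2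
    have hteq : t = (w ^ 2 + algebraMap k M a) / (1 - 2 * w) := by
      rw [eq_div_iff hu, htw]
    refine ⟨w, q * (1 - 2 * w) / (w + algebraMap k M c ^ 2),
      r * (1 - 2 * w) / (w + (algebraMap k M c ^ 2 + 2 * algebraMap k M c)), ⟨hw, ?_, ?_⟩, ?_⟩
    · rw [div_pow, div_eq_iff (pow_ne_zero _ hv1), mul_comm (Polynomial.aeval _ _), ← hQ]
      linear_combination (1 - 2 * w) ^ 2 * h2 +
        (t * (1 - 2 * w) + w ^ 2 + algebraMap k M a + 1 - 2 * w) * htw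
    · rw [div_pow, div_eq_iff (pow_ne_zero _ hv2), mul_comm (Polynomial.aeval _ _), ← hR]
      linear_combination (1 - 2 * w) ^ 2 * h3 +
        (t * (1 - 2 * w) + w ^ 2 + algebraMap k M a - (1 - 2 * w)) * htw
    · set L := adjoin k {w, q * (1 - 2 * w) / (w + algebraMap k M c ^ 2),
        r * (1 - 2 * w) / (w + (algebraMap k M c ^ 2 + 2 * algebraMap k M c))} with hL
      have hwL : w ∈ L := subset_adjoin k _ (by simp)
      have hAL : q * (1 - 2 * w) / (w + algebraMap k M c ^ 2) ∈ L := subset_adjoin k _ (by simp)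
      have hBL : r * (1 - 2 * w) / (w + (algebraMap k M c ^ 2 + 2 * algebraMap k M c)) ∈ L :=
        subset_adjoin k _ (by simp)
      have hconst : ∀ {N : IntermediateField k M} (e : k), algebraMap k M e ∈ N :=
        fun {N} e => N.algebraMap_mem e
      have huL : ∀ {N : IntermediateField k M}, w ∈ N → 1 - 2 * w ∈ N := fun {N} hN =>
        sub_mem (one_mem _) (mul_mem (ofNat_mem N 2) hN)
      have hvL : ∀ {N : IntermediateField k M}, w ∈ N → w + algebraMap k M c ^ 2 ∈ N :=
        fun {N} hN => add_mem hN (pow_mem (hconst c) 2)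
      have hvL' : ∀ {N : IntermediateField k M}, w ∈ N →
          w + (algebraMap k M c ^ 2 + 2 * algebraMap k M c) ∈ N := fun {N} hN =>
        add_mem hN (add_mem (pow_mem (hconst c) 2) (mul_mem (ofNat_mem N 2) (hconst c)))
      have htL : t ∈ L := by
        rw [hteq]
        exact div_mem (add_mem (pow_mem hwL 2) (hconst a)) (huL hwL)
      apply le_antisymm
      · rw [adjoin_le_iff]
        have hmul : ∀ x y : M, y ≠ 0 → y ∈ L → x * (1 - 2 * w) / y ∈ L → x ∈ L := by
          intro x y hy hyL hx
          have : x = x * (1 - 2 * w) / y * y / (1 - 2 * w) := by field_simp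
          rw [this]
          exact div_mem (mul_mem hx hyL) (huL hwL)
        rintro _ (rfl | rfl | rfl | rfl)
        exacts [hmul _ _ hv1 (hvL hwL) hAL, hmul _ _ hv2 (hvL' hwL) hBL, add_mem htL hwL, htL]
      · rw [hL, adjoin_le_iff]
        have hgen : ∀ x ∈ ({q, r, t + w, t} : Set M), x ∈ adjoin k {q, r, t + w, t} :=
          fun x hx => subset_adjoin k _ hx
        have hwN : w ∈ adjoin k {q, r, t + w, t} := by
          have := sub_mem (hgen (t + w) (by simp)) (hgen t (by simp))
          rwa [add_sub_cancel_left] at this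
        rintro _ (rfl | rfl | rfl)
        · exact hwN
        · exact div_mem (mul_mem (hgen _ (by simp)) (huL hwN)) (hvL hwN)
        · exact div_mem (mul_mem (hgen _ (by simp)) (huL hwN)) (hvL' hwN)
  · intro M _ _ w A B h
    obtain ⟨hu, hv⟩ := hne h.transcendental
    have hv1 := hv (c ^ 2)
    have hv2 := hv (c ^ 2 + 2 * c)
    simp only [map_add, map_mul, map_pow, map_ofNat] at hv1 hv2
    have hwE := mem_adjoin_simple_self k w
    have hconst : ∀ e : k, algebraMap k M e ∈ k⟮w⟯ := fun e => (k⟮w⟯).algebraMap_mem e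
    have huE : 1 - 2 * w ∈ k⟮w⟯ := sub_mem (one_mem _) (mul_mem (ofNat_mem _ 2) hwE)
    have htE : (w ^ 2 + algebraMap k M a) / (1 - 2 * w) ∈ k⟮w⟯ :=
      div_mem (add_mem (pow_mem hwE 2) (hconst a)) huE
    obtain ⟨t, ht⟩ : ∃ t, t = (w ^ 2 + algebraMap k M a) / (1 - 2 * w) := ⟨_, rfl⟩
    rw [← ht] at htE
    rw [eq_div_iff hu] at ht
    refine ⟨(w + algebraMap k M c ^ 2) / (1 - 2 * w),
      div_mem (add_mem hwE (pow_mem (hconst c) 2)) huE,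
      (w + (algebraMap k M c ^ 2 + 2 * algebraMap k M c)) / (1 - 2 * w),
      div_mem (add_mem hwE (add_mem (pow_mem (hconst c) 2)
        (mul_mem (ofNat_mem _ 2) (hconst c)))) huE,
      t + w, add_mem htE hwE, t, htE, div_ne_zero hv1 hu, div_ne_zero hv2 hu, ?_, ?_, ?_, ?_⟩
    · by_contra htr
      obtain ⟨e, rfl⟩ := exists_algebraMap_eq_of_not_transcendental htr
      -- At `1/2` the coefficient of `e` disappears and the value is `-(1 + 4a)/4`, nonzero for
      -- every `e`.
      refine aeval_ne_zero_of_eval_ne_zero h.transcendental (Polynomial.C e *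
        (1 - 2 * Polynomial.X) - Polynomial.X ^ 2 - Polynomial.C a) (1 / 2) ?_ ?_
      · simp only [Polynomial.eval_sub, Polynomial.eval_mul, Polynomial.eval_C,
          Polynomial.eval_one, Polynomial.eval_ofNat, Polynomial.eval_X, Polynomial.eval_pow]
        exact fun h0 => ha4 (by linear_combination -4 * h0)
      · simp only [map_sub, map_one, map_mul, map_pow, map_ofNat, Polynomial.aeval_X,
          Polynomial.aeval_C]
        linear_combination ht
    · linear_combination -ht
    · rw [mul_pow, h.sq_left, div_pow, div_mul_eq_mul_div, ← hQ, div_eq_iff (pow_ne_zero 2 hu)]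
      linear_combination -(t * (1 - 2 * w) + w ^ 2 + algebraMap k M a + 1 - 2 * w) * ht
    · rw [mul_pow, h.sq_right, div_pow, div_mul_eq_mul_div, ← hR, div_eq_iff (pow_ne_zero 2 hu)]
      linear_combination -(t * (1 - 2 * w) + w ^ 2 + algebraMap k M a - (1 - 2 * w)) * ht

end CriticalFiber

end SpecialFibers

theorem theorem4p4 {k : Type*} [Field k] [IsAlgClosed k] [CharZero k] :
    {a : k | IsCriticalValue 3 a}.ncard = 3 ∧
    IsIrreducibleCurveOfGenus (C224 (0 : k)) 4 ∧
    ∀ a : k, IsCriticalValue 3 a → IsIrreducibleCurveOfGenus (C224 a) 1 :=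
  ⟨ncard_isCriticalValue_three, isIrreducibleCurveOfGenus_C224_zero,
    fun _ => isIrreducibleCurveOfGenus_C224_of_isCriticalValue⟩
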